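/- Let $G=(V,E)$ be a finite undirected (multi)graph with edge costs $c_e\ge 0$, and let $\mathcal F$ be a family of subsets of $V$. For $J\subseteq E$ and $S\subseteq V$ let $d_J(S)$ be the number of edges of $J$ with exactly one end in $S$; $J$ covers $S$ if $d_J(S)\ge 1$, and $J$ is a cover of $\mathcal F$ if it covers every $S\in\mathcal F$. Set Family Edge Cover asks for a cover $J\subseteq E$ of $\mathcal F$ of minimum cost. The residual family is $\mathcal F^J=\{S\in\mathcal F: d_J(S)=0\}$, and the cores of a family are its inclusion-minimal members. Two sets $A,B\subseteq V$ cross if $A\cap B$, $V\setminus(A\cup B)$, $A\setminus B$, $B\setminus A$ are all non-empty. The family $\mathcal F$ is pliable if $\emptyset,V\notin\mathcal F$ and for all $A,B\in\mathcal F$ at least two of the four sets $A\cap B$, $A\cup B$, $A\setminus B$, $B\setminus A$ (counted with repetition) are in $\mathcal F$. It is $\gamma$-pliable if it is pliable and, for all $I\subseteq E$, all $S_1\subsetneq S_2$ in $\mathcal F^I$ and every core $C$ of $\mathcal F^I$ that crosses both $S_1$ and $S_2$, the set $S_2\setminus(S_1\cup C)$ is empty or belongs to $\mathcal F^I$. The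 WGMV primal-dual algorithm with reverse delete works as follows. Phase 1 starts with $J=\emptyset$ and $y=0$; while $\mathcal F^J$ has cores, it raises the dual variables $y_C$ of all cores $C$ of $\mathcal F^J$ uniformly (possibly by zero), keeping $\sum_{S\in\mathcal F:\,e\text{ covers }S}y_S\le c_e$ for all $e\in E$, until equality holds for some $e\in E\setminus J$, and adds such an edge $e$ (chosen arbitrarily) to $J$. Phase 2 processes the edges in the reverse order of their addition and deletes an edge from $J$ whenever the rest of $J$ still covers $\mathcal F$. **Theorem.** Let $\mathcal F$ be $\gamma$-pliable. 1. Every output $J$ of the WGMV algorithm is a cover of $\mathcal F$ with $\sum_{e\in J}c_e\le 7\sum_{e\in J'}c_e$ for every cover $J'\subseteq E$ of $\mathcal F$. 2. There are a single program $P$ and a single polynomial $p$ such that on every input with $n$ nodes, $m$ edges, non-negative real costs and a $\gamma$-pliable family $\mathcal F$ that is covered by $E$, given an oracle that lists the cores of $\mathcal F^J$ for each $J\subseteq E$ that is queried, $P$ halts after at most $p(n+m)$ steps with an output of the WGMV algorithm, which is therefore a $7$-approximate solution. Here a step is an oracle query (the number of cores of $\mathcal F^J$, or whether a given node is in the $i$-th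 core), a memory access, an assignment, a comparison, an addition or subtraction of integers or of costs, or the multiplication or division of a cost by an integer. 3. If $I\subseteq E$ is an inclusion-minimal cover of $\mathcal F$ such that every edge of $I$ covers some core of $\mathcal F$, and $\mathcal C$ is the set of cores of $\mathcal F$, then $\sum_{C\in\mathcal C}d_I(C)\le 7|\mathcal C|$. -/

import Mathlib

namespace SetCover

/-! ### Graphs, set families, cores, residual families -/

/-- A multigraph with node set `V` and edge set `E`: each edge has two ends. The edges are
undirected, the order in which the two ends are listed is never used below. -/
structure Multigraph (V E : Type*) where
  ends : E → V × V

section Families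

variable {V E : Type*} [DecidableEq V]

/-- The edge `e` covers the node set `S`: exactly one end of `e` lies in `S`. -/
def Multigraph.Covers (G : Multigraph V E) (e : E) (S : Finset V) : Prop :=
  ((G.ends e).1 ∈ S ∧ (G.ends e).2 ∉ S) ∨ ((G.ends e).1 ∉ S ∧ (G.ends e).2 ∈ S)

instance (G : Multigraph V E) (e : E) (S : Finset V) : Decidable (G.Covers e S) := by
  unfold Multigraph.Covers
  infer_instance

/-- `d_J(S)`: the number of edges of `J` with exactly one end in `S`. -/
def Multigraph.deg (G : Multigraph V E) (J : Finset E) (S : Finset V) : ℕ :=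
  (J.filter fun e => G.Covers e S).card

/-- `J` covers the family `F`, that is, `d_J(S) ≥ 1` for all `S ∈ F`. -/
def Multigraph.IsCover (G : Multigraph V E) (F : Finset (Finset V)) (J : Finset E) : Prop :=
  ∀ S ∈ F, 1 ≤ G.deg J S

instance (G : Multigraph V E) (F : Finset (Finset V)) (J : Finset E) :
    Decidable (G.IsCover F J) := by
  unfold Multigraph.IsCover
  infer_instance

/-- The residual family `F^J`: the members of `F` that `J` does not cover. -/
def Multigraph.residual (G : Multigraph V E) (F : Finset (Finset V)) (J : Finset E) :
    Finset (Finset V) :=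
  F.filter fun S => G.deg J S = 0

/-- The `F`-cores: the inclusion-minimal members of `F`. -/
def cores (F : Finset (Finset V)) : Finset (Finset V) :=
  F.filter fun C => ∀ S ∈ F, S ⊆ C → S = C

variable [Fintype V]

/-- Two node sets cross. -/
def Cross (A B : Finset V) : Prop :=
  (A ∩ B).Nonempty ∧ (Finset.univ \ (A ∪ B)).Nonempty ∧ (A \ B).Nonempty ∧ (B \ A).Nonempty

/-- Pliable families. The four sets are counted as four items, equal sets being counted
repeatedly, so that the condition is automatic for nested and for disjoint `A, B`. -/
def Pliable (F : Finset (Finset V)) : Prop :=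
  ∅ ∉ F ∧ Finset.univ ∉ F ∧
    ∀ A ∈ F, ∀ B ∈ F, 2 ≤ [A ∩ B, A ∪ B, A \ B, B \ A].countP fun S => decide (S ∈ F)

/-- Property (γ), for the edge sets `I` of the graph `G`. -/
def PropertyGamma (G : Multigraph V E) (F : Finset (Finset V)) : Prop :=
  ∀ I : Finset E, ∀ S₁ ∈ G.residual F I, ∀ S₂ ∈ G.residual F I, S₁ ⊂ S₂ →
    ∀ C ∈ cores (G.residual F I), Cross C S₁ → Cross C S₂ →
      S₂ \ (S₁ ∪ C) = ∅ ∨ S₂ \ (S₁ ∪ C) ∈ G.residual F I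

/-- γ-pliable families. -/
def GammaPliable (G : Multigraph V E) (F : Finset (Finset V)) : Prop :=
  Pliable F ∧ PropertyGamma G F

end Families

/-! ### Set Family Edge Cover and the primal-dual algorithm with reverse delete -/

section Algorithm

variable {V E : Type*} [DecidableEq V]

/-- The cost of an edge set. -/
def cost (c : E → ℝ) (J : Finset E) : ℝ := ∑ e ∈ J, c e

/-- `J` is a feasible solution whose cost is at most `ρ` times the optimum. -/
def IsApproxSolution (G : Multigraph V E) (c : E → ℝ) (F : Finset (Finset V)) (ρ : ℝ)
    (J : Finset E) : Prop :=
  G.IsCover F J ∧ ∀ J' : Finset E, G.IsCover F J' → cost c J ≤ ρ * cost c J'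

/-- The left-hand side of the dual constraint of the edge `e`. -/
def load (G : Multigraph V E) (F : Finset (Finset V)) (y : Finset V → ℝ) (e : E) : ℝ :=
  ∑ S ∈ F with G.Covers e S, y S

/-- Raise the dual variables of the sets in `K` uniformly by `ε`. -/
def raise (K : Finset (Finset V)) (ε : ℝ) (y : Finset V → ℝ) : Finset V → ℝ :=
  fun S => if S ∈ K then y S + ε else y S

variable [DecidableEq E]

/-- Phase 1. `Phase1 G c F L y` says that some sequence of iterations produces the dual solution
`y` and the edges in `L`, where `L` lists the edges that were picked, the latest one first.
An iteration is made only while there are residual cores. It raises the dual variables of all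
residual cores by one and the same `ε ≥ 0`, such that no constraint of an edge outside `L` is
violated and that the edge `e` outside `L` is tight; then `e` is added. The choice of the tight
edge is free. -/
inductive Phase1 (G : Multigraph V E) (c : E → ℝ) (F : Finset (Finset V)) :
    List E → (Finset V → ℝ) → Prop
  | start : Phase1 G c F [] (fun _ => 0)
  | step (L : List E) (y : Finset V → ℝ) (ε : ℝ) (e : E) :
      Phase1 G c F L y →
      (cores (G.residual F L.toFinset)).Nonempty →
      0 ≤ ε →
      (∀ f, f ∉ L → load G F (raise (cores (G.residual F L.toFinset)) ε y) f ≤ c f) →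
      e ∉ L →
      load G F (raise (cores (G.residual F L.toFinset)) ε y) e = c e →
      Phase1 G c F (e :: L) (raise (cores (G.residual F L.toFinset)) ε y)

/-- Phase 2. The edges of the list are processed from the head on; an edge is deleted from the
current edge set if what remains is still a cover. -/
def reverseDelete (G : Multigraph V E) (F : Finset (Finset V)) :
    List E → Finset E → Finset E
  | [], J => J
  | e :: L, J => reverseDelete G F L (if G.IsCover F (J.erase e) then J.erase e else J)

/-- `J` is an output of the primal-dual algorithm: Phase 1 is run until there is no residual
core, and then Phase 2 processes the edges in the reverse order of their addition. -/
def IsWGMVOutput (G : Multigraph V E) (c : E → ℝ) (F : Finset (Finset V)) (J : Finset E) :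
    Prop :=
  ∃ (L : List E) (y : Finset V → ℝ),
    Phase1 G c F L y ∧ cores (G.residual F L.toFinset) = ∅ ∧
      J = reverseDelete G F L L.toFinset

end Algorithm

/-! ### Programs with a core oracle, and their running time

The memory consists of arrays of natural numbers and arrays of real numbers, each array having a
numeral as its name. Natural numbers can be added and subtracted (truncated) and compared. Real
numbers can be added, subtracted, multiplied and divided by a natural number, and compared;
there is no product of two natural numbers or of two real numbers, and no rounding, so that the
length of the numbers stays polynomial in the number of steps. Programs are built from
assignments, conditionals and while loops. Each operation, memory access, comparison and
oracle query counts as one step. -/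

/-- Expressions with values in the natural numbers. `coreCount a` and `inCore a i v` are queries
to the oracle on the edge set that is stored in the array `a`. -/
inductive NExp where
  | lit (k : ℕ)
  | get (a : ℕ) (i : NExp)
  | add (x y : NExp)
  | sub (x y : NExp)
  | coreCount (a : ℕ)
  | inCore (a : ℕ) (i v : NExp)

/-- Expressions with real values. -/
inductive RExp where
  | get (a : ℕ) (i : NExp)
  | add (x y : RExp)
  | sub (x y : RExp)
  | mulNat (x : RExp) (k : NExp)
  | divNat (x : RExp) (k : NExp)

/-- Tests. -/
inductive BExp where
  | natLe (x y : NExp)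
  | realLe (x y : RExp)
  | neg (b : BExp)
  | conj (b b' : BExp)

/-- Programs. -/
inductive Cmd where
  | skip
  | setNat (a : ℕ) (i x : NExp)
  | setReal (a : ℕ) (i : NExp) (x : RExp)
  | seq (p q : Cmd)
  | ite (b : BExp) (p q : Cmd)
  | loop (b : BExp) (p : Cmd)

/-- The memory: `nat a i` is the cell `i` of the array `a` of natural numbers, and `real a i`
the cell `i` of the array `a` of real numbers. -/
structure Store where
  nat : ℕ → ℕ → ℕ
  real : ℕ → ℕ → ℝ

/-- Overwrite one cell with a natural number. -/
def Store.writeNat (σ : Store) (a i x : ℕ) : Store :=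
  { σ with nat := Function.update σ.nat a (Function.update (σ.nat a) i x) }

/-- Overwrite one cell with a real number. -/
noncomputable def Store.writeReal (σ : Store) (a i : ℕ) (x : ℝ) : Store :=
  { σ with real := Function.update σ.real a (Function.update (σ.real a) i x) }

/-- The edge set stored in an array: the edges whose cell is not zero. -/
def decodeEdges (m : ℕ) (f : ℕ → ℕ) : Finset (Fin m) :=
  Finset.univ.filter fun e => f e ≠ 0

/-- An oracle maps an edge set to a list of node sets. -/
abbrev Oracle (n m : ℕ) : Type := Finset (Fin m) → List (Finset (Fin n))

/-- The oracle lists, without repetition and in any order, the cores of the residual family of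
each edge set of the graph. -/
def IsCoreOracle {n m : ℕ} (G : Multigraph (Fin n) (Fin m)) (F : Finset (Finset (Fin n)))
    (O : Oracle n m) : Prop :=
  ∀ J : Finset (Fin m), (O J).Nodup ∧ ∀ C, C ∈ O J ↔ C ∈ cores (G.residual F J)

/-- The answer, 1 or 0, to the question whether the node `v` is in the set with number `i`. -/
def memberBit {n : ℕ} (l : List (Finset (Fin n))) (i v : ℕ) : ℕ :=
  if h : i < l.length ∧ v < n then (if (⟨v, h.2⟩ : Fin n) ∈ l[i]'h.1 then 1 else 0) else 0

/-- The value of an expression in the natural numbers. -/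
def NExp.eval {n m : ℕ} (O : Oracle n m) (σ : Store) : NExp → ℕ
  | lit k => k
  | get a i => σ.nat a (i.eval O σ)
  | add x y => x.eval O σ + y.eval O σ
  | sub x y => x.eval O σ - y.eval O σ
  | coreCount a => (O (decodeEdges m (σ.nat a))).length
  | inCore a i v => memberBit (O (decodeEdges m (σ.nat a))) (i.eval O σ) (v.eval O σ)

/-- The value of a real expression. -/
noncomputable def RExp.eval {n m : ℕ} (O : Oracle n m) (σ : Store) : RExp → ℝ
  | get a i => σ.real a (i.eval O σ)
  | add x y => x.eval O σ + y.eval O σ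
  | sub x y => x.eval O σ - y.eval O σ
  | mulNat x k => x.eval O σ * (k.eval O σ : ℝ)
  | divNat x k => x.eval O σ / (k.eval O σ : ℝ)

/-- The truth of a test. -/
def BExp.Holds {n m : ℕ} (O : Oracle n m) (σ : Store) : BExp → Prop
  | natLe x y => x.eval O σ ≤ y.eval O σ
  | realLe x y => x.eval O σ ≤ y.eval O σ
  | neg b => ¬ b.Holds O σ
  | conj b b' => b.Holds O σ ∧ b'.Holds O σ

/-- The number of steps that the evaluation of an expression takes. -/
def NExp.steps : NExp → ℕ
  | lit _ => 1
  | get _ i => i.steps + 1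
  | add x y => x.steps + y.steps + 1
  | sub x y => x.steps + y.steps + 1
  | coreCount _ => 1
  | inCore _ i v => i.steps + v.steps + 1

/-- The number of steps that the evaluation of a real expression takes. -/
def RExp.steps : RExp → ℕ
  | get _ i => i.steps + 1
  | add x y => x.steps + y.steps + 1
  | sub x y => x.steps + y.steps + 1
  | mulNat x k => x.steps + k.steps + 1
  | divNat x k => x.steps + k.steps + 1

/-- The number of steps that the evaluation of a test takes. -/
def BExp.steps : BExp → ℕ
  | natLe x y => x.steps + y.steps + 1
  | realLe x y => x.steps + y.steps + 1
  | neg b => b.steps + 1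
  | conj b b' => b.steps + b'.steps + 1

/-- `Exec O p σ τ t`: the program `p`, started in the memory `σ`, halts in the memory `τ` after
exactly `t` steps. -/
inductive Exec {n m : ℕ} (O : Oracle n m) : Cmd → Store → Store → ℕ → Prop
  | skip (σ : Store) : Exec O .skip σ σ 1
  | setNat (a : ℕ) (i x : NExp) (σ : Store) :
      Exec O (.setNat a i x) σ (σ.writeNat a (i.eval O σ) (x.eval O σ)) (i.steps + x.steps + 1)
  | setReal (a : ℕ) (i : NExp) (x : RExp) (σ : Store) :
      Exec O (.setReal a i x) σ (σ.writeReal a (i.eval O σ) (x.eval O σ)) (i.steps + x.steps + 1)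
  | seq {p q : Cmd} {σ τ υ : Store} {s t : ℕ} :
      Exec O p σ τ s → Exec O q τ υ t → Exec O (.seq p q) σ υ (s + t)
  | iteTrue {b : BExp} {p q : Cmd} {σ τ : Store} {t : ℕ} :
      b.Holds O σ → Exec O p σ τ t → Exec O (.ite b p q) σ τ (b.steps + t + 1)
  | iteFalse {b : BExp} {p q : Cmd} {σ τ : Store} {t : ℕ} :
      ¬ b.Holds O σ → Exec O q σ τ t → Exec O (.ite b p q) σ τ (b.steps + t + 1)
  | loopDone {b : BExp} {p : Cmd} {σ : Store} :
      ¬ b.Holds O σ → Exec O (.loop b p) σ σ (b.steps + 1)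
  | loopStep {b : BExp} {p : Cmd} {σ τ υ : Store} {s t : ℕ} :
      b.Holds O σ → Exec O p σ τ s → Exec O (.loop b p) τ υ t →
        Exec O (.loop b p) σ υ (b.steps + s + t + 1)

/-- The memory at the start. Array 0 of natural numbers holds the number `n` of nodes and the
number `m` of edges, arrays 1 and 2 hold the first and the second ends of the edges, and array 0
of real numbers holds the costs of the edges. All other cells are 0. -/
noncomputable def inputStore {n m : ℕ} (G : Multigraph (Fin n) (Fin m)) (c : Fin m → ℝ) : Store where
  nat a i :=
    if a = 0 then (if i = 0 then n else if i = 1 then m else 0)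
    else if h : i < m then
      (if a = 1 then ((G.ends ⟨i, h⟩).1 : ℕ) else if a = 2 then ((G.ends ⟨i, h⟩).2 : ℕ) else 0)
    else 0
  real a i := if h : i < m then (if a = 0 then c ⟨i, h⟩ else 0) else 0

/-- The edge set that is read off at the end, from array 3 of natural numbers. -/
def outputEdges (m : ℕ) (τ : Store) : Finset (Fin m) :=
  decodeEdges m (τ.nat 3)

end SetCover

/-!
The heart of the proof is the degree bound: the cores of a γ-pliable family have average degree at
most 7 with respect to a minimal cover `I`. Uncrossing gives every edge of `I` a witness set, a
member of the family that no other edge of `I` covers, such that the witness sets are laminar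
(`exists_isLaminarWitness`). They form a forest in which the edge of a witness set joins it to its
parent. If all cores stayed clear of the boundaries of the witness sets, the usual counting of tree
edges would give the factor 2. Here a core may cross witness sets, and there may be chains of
witness sets with only one child and without a core of their own. Property (γ) makes a core that
crosses the child of such a chain node contain everything that the node adds to its child. As every
edge covers some core, a chain then has at most three nodes, and an edge between two cores can occur
only at special places. `WitnessForest` records what is needed of this situation. Each core gets a
budget of 7, and `WitnessForest.SlackBound` is the invariant, proved from the leaves upwards, that
says how much of the budget inside a witness set is left after its edges have been paid for.

An output of the primal-dual algorithm restricts, in every iteration of the first phase, to a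
minimal cover of the residual family (`not_isCover_reverseDelete`), so that the degree bound
compares the increase of the cost of the output with the increase of the dual objective
(`Phase1.sum_deg_mul_le`). Weak duality gives the factor 7.

The program `Program.wgmv` performs the two phases literally. In an iteration it selects an edge for
which the ratio of the remaining cost to the number of residual cores that it covers is smallest;
this ratio is the amount by which the dual variables are raised. Its running time follows from a
small calculus of time-bounded total correctness, `Runs`.
-/

namespace SetCover

/-! ### Coverage, residual families and cores -/

section Families

variable {V E : Type*} [DecidableEq V] {G : Multigraph V E} {F : Finset (Finset V)}
  {A B C D S : Finset V} {J I : Finset E} {e : E}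

theorem Multigraph.covers_iff :
    G.Covers e S ↔ ¬ ((G.ends e).1 ∈ S ↔ (G.ends e).2 ∈ S) := by
  unfold Multigraph.Covers
  tauto

theorem Multigraph.deg_eq_zero_iff : G.deg J S = 0 ↔ ∀ e ∈ J, ¬ G.Covers e S := by
  simp [Multigraph.deg, Finset.filter_eq_empty_iff]

theorem Multigraph.mem_residual :
    S ∈ G.residual F J ↔ S ∈ F ∧ ∀ e ∈ J, ¬ G.Covers e S := by
  simp [Multigraph.residual, Multigraph.deg_eq_zero_iff]

theorem Multigraph.isCover_iff : G.IsCover F J ↔ ∀ S ∈ F, ∃ e ∈ J, G.Covers e S := by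
  refine forall₂_congr fun S _ => ?_
  rw [Nat.one_le_iff_ne_zero, Ne, Multigraph.deg_eq_zero_iff]
  push Not
  rfl

theorem Multigraph.IsCover.mono {J' : Finset E} (h : G.IsCover F J) (hJ : J ⊆ J') :
    G.IsCover F J' := by
  rw [isCover_iff] at h ⊢
  intro S hS
  obtain ⟨e, he, hc⟩ := h S hS
  exact ⟨e, hJ he, hc⟩

theorem Multigraph.residual_residual [DecidableEq E] :
    G.residual (G.residual F J) I = G.residual F (J ∪ I) := by
  ext S
  simp only [mem_residual, Finset.mem_union]
  constructor
  · rintro ⟨⟨h, h1⟩, h2⟩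
    exact ⟨h, fun e he => he.elim (h1 e) (h2 e)⟩
  · rintro ⟨h, h1⟩
    exact ⟨⟨h, fun e he => h1 e (Or.inl he)⟩, fun e he => h1 e (Or.inr he)⟩

theorem mem_cores : C ∈ cores F ↔ C ∈ F ∧ ∀ S ∈ F, S ⊆ C → S = C := by
  simp [cores]

theorem exists_core_subset (hS : S ∈ F) : ∃ C ∈ cores F, C ⊆ S := by
  obtain ⟨C, hCS, hC⟩ := F.exists_le_minimal hS
  exact ⟨C, mem_cores.2 ⟨hC.prop, fun T hT h => le_antisymm h (hC.le_of_le hT h)⟩, hCS⟩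

theorem cores_residual_eq_empty_iff :
    cores (G.residual F J) = ∅ ↔ G.IsCover F J := by
  rw [Multigraph.isCover_iff]
  constructor
  · intro h S hS
    by_contra! hc
    obtain ⟨C, hC, -⟩ := exists_core_subset (Multigraph.mem_residual.2 ⟨hS, hc⟩)
    simp [h] at hC
  · intro h
    refine Finset.eq_empty_of_forall_notMem fun C hC => ?_
    obtain ⟨hF, hn⟩ := Multigraph.mem_residual.1 (mem_cores.1 hC).1
    obtain ⟨e, he, hc⟩ := h C hF
    exact hn e he hc

variable [Fintype V]

/-- Of any three of the four sets in the definition of a pliable family, one is a member. -/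
theorem Pliable.corners (hF : Pliable F) (hA : A ∈ F) (hB : B ∈ F) :
    (A ∩ B ∈ F ∨ A ∪ B ∈ F ∨ A \ B ∈ F) ∧ (A ∩ B ∈ F ∨ A ∪ B ∈ F ∨ B \ A ∈ F) ∧
      (A ∩ B ∈ F ∨ A \ B ∈ F ∨ B \ A ∈ F) ∧ (A ∪ B ∈ F ∨ A \ B ∈ F ∨ B \ A ∈ F) := by
  have h := hF.2.2 A hA B hB
  simp only [List.countP_cons, List.countP_nil, decide_eq_true_eq] at h
  by_cases h1 : A ∩ B ∈ F <;> by_cases h2 : A ∪ B ∈ F <;> by_cases h3 : A \ B ∈ F <;>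
    by_cases h4 : B \ A ∈ F <;> simp [h1, h2, h3, h4] at h ⊢

theorem Pliable.nonempty (hF : Pliable F) (hS : S ∈ F) : S.Nonempty :=
  Finset.nonempty_of_ne_empty fun h => hF.1 (h ▸ hS)

theorem Pliable.residual (hF : Pliable F) (J : Finset E) : Pliable (G.residual F J) := by
  refine ⟨fun h => hF.1 (Multigraph.mem_residual.1 h).1,
    fun h => hF.2.1 (Multigraph.mem_residual.1 h).1, fun A hA B hB => ?_⟩
  rw [Multigraph.mem_residual] at hA hB
  refine (hF.2.2 A hA.1 B hB.1).trans (List.countP_mono_left fun S hS hSF => ?_)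
  simp only [decide_eq_true_eq] at hSF ⊢
  refine Multigraph.mem_residual.2 ⟨hSF, fun e he => ?_⟩
  have h1 := hA.2 e he
  have h2 := hB.2 e he
  rw [Multigraph.covers_iff, not_not] at h1 h2 ⊢
  simp only [List.mem_cons, List.not_mem_nil, or_false] at hS
  rcases hS with rfl | rfl | rfl | rfl <;> simp [h1, h2]

theorem GammaPliable.residual (hF : GammaPliable G F) (J : Finset E) :
    GammaPliable G (G.residual F J) := by
  classical
  refine ⟨hF.1.residual J, fun I => ?_⟩
  rw [Multigraph.residual_residual]
  exact hF.2 (J ∪ I)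

theorem Pliable.disjoint_cores (hF : Pliable F) (hC : C ∈ cores F) (hD : D ∈ cores F)
    (hne : C ≠ D) : Disjoint C D := by
  rw [mem_cores] at hC hD
  by_contra hdis
  obtain ⟨x, hxC, hxD⟩ := Finset.not_disjoint_iff.1 hdis
  have h1 : C ∩ D ∉ F := fun h => hne ((hC.2 _ h Finset.inter_subset_left).symm.trans
    (hD.2 _ h Finset.inter_subset_right))
  have h2 : C \ D ∉ F := fun h => by
    have := hC.2 _ h Finset.sdiff_subset
    rw [← this] at hxC
    exact (Finset.mem_sdiff.1 hxC).2 hxD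
  have h3 : D \ C ∉ F := fun h => by
    have := hD.2 _ h Finset.sdiff_subset
    rw [← this] at hxD
    exact (Finset.mem_sdiff.1 hxD).2 hxC
  have := (hF.corners hC.1 hD.1).2.2.1
  tauto

/-- A core that meets a member of a pliable family without being contained in it crosses it. -/
theorem Pliable.cross_of_mem_cores (hF : Pliable F) (hC : C ∈ cores F) (hS : S ∈ F)
    (hne : (C ∩ S).Nonempty) (hsub : ¬ C ⊆ S) : Cross C S := by
  rw [mem_cores] at hC
  refine ⟨hne, ?_, Finset.sdiff_nonempty.2 hsub, Finset.sdiff_nonempty.2 fun h => ?_⟩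
  · by_contra hu
    rw [Finset.not_nonempty_iff_eq_empty, Finset.sdiff_eq_empty_iff_subset,
      Finset.univ_subset_iff] at hu
    have h0 : C ∪ S ∉ F := hu ▸ hF.2.1
    have h1 : C ∩ S ∉ F := fun h => hsub (by
      rw [← hC.2 _ h Finset.inter_subset_left]
      exact Finset.inter_subset_right)
    have h2 : C \ S ∉ F := fun h => by
      obtain ⟨x, hx⟩ := hne
      rw [Finset.mem_inter] at hx
      have := hx.1
      rw [← hC.2 _ h Finset.sdiff_subset] at this
      exact (Finset.mem_sdiff.1 this).2 hx.2
    have := (hF.corners hC.1 hS).1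
    tauto
  · exact hsub (hC.2 S hS h).ge

end Families

/-! ### The degree bound for a laminar family of witness sets -/

/-- A laminar family `L` of witness sets together with the cores `K`. The witness set `S ∈ L`
belongs to an edge with the ends `lo S ∈ S` and `up S ∉ S`, and that edge covers no other member
of `L`. Ordered by inclusion, `L` is a forest, and the edge of `S` joins the part of `S` outside
the children of `S` to the corresponding part of the parent of `S`. -/
structure WitnessForest (V : Type*) [DecidableEq V] where
  L : Finset (Finset V)
  K : Finset (Finset V)
  lo : Finset V → V
  up : Finset V → V
  laminar : ∀ S ∈ L, ∀ T ∈ L, S ⊆ T ∨ T ⊆ S ∨ Disjoint S T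
  lo_mem : ∀ S ∈ L, lo S ∈ S
  up_notMem : ∀ S ∈ L, up S ∉ S
  lo_mem_iff : ∀ S ∈ L, ∀ T ∈ L, S ≠ T → (lo S ∈ T ↔ up S ∈ T)
  core_nonempty : ∀ C ∈ K, C.Nonempty
  core_disjoint : ∀ C ∈ K, ∀ D ∈ K, C ≠ D → Disjoint C D
  exists_core : ∀ S ∈ L, ∃ C ∈ K, C ⊆ S
  /-- The consequence of property (γ): between two nested witness sets that a core crosses there
  is either another core or nothing outside the crossing core. -/
  gap : ∀ S ∈ L, ∀ T ∈ L, S ⊂ T → ∀ C ∈ K, (C ∩ S).Nonempty → ¬ C ⊆ T →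
    T ⊆ S ∪ C ∨ ∃ D ∈ K, D ⊆ T \ S
  covers_core : ∀ S ∈ L, ∃ C ∈ K, ¬ (lo S ∈ C ↔ up S ∈ C)

namespace WitnessForest

variable {V : Type*} [DecidableEq V] (W : WitnessForest V) {S T P Q R U C D : Finset V}

/-- The number of cores that the edge of the witness set `S` covers. -/
def weight (S : Finset V) : ℕ := (W.K.filter fun C => ¬ (W.lo S ∈ C ↔ W.up S ∈ C)).card

/-- The two ends of the edge of `S` lie in different cores. -/
def Double (S : Finset V) : Prop :=
  ∃ C ∈ W.K, ∃ D ∈ W.K, C ≠ D ∧ W.lo S ∈ C ∧ W.up S ∈ D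

/-- The two ends of the edge of `S` lie in different cores, and the core of the lower end
crosses `S`. -/
def CrossDouble (S : Finset V) : Prop :=
  ∃ C ∈ W.K, ∃ D ∈ W.K, C ≠ D ∧ W.lo S ∈ C ∧ W.up S ∈ D ∧ ¬ C ⊆ S

/-- `P` is a witness set whose only child is `S` and all of whose cores lie in `S`. -/
def Chain (S P : Finset V) : Prop :=
  P ∈ W.L ∧ S ⊂ P ∧ (∀ T ∈ W.L, T ⊂ P → T ⊆ S) ∧ ∀ C ∈ W.K, C ⊆ P → C ⊆ S

/-- The maximal witness sets that are strictly contained in `S`. -/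
def children (S : Finset V) : Finset (Finset V) :=
  W.L.filter fun U => U ⊂ S ∧ ∀ T ∈ W.L, T ⊂ S → U ⊆ T → U = T

/-- The cores that lie in `S` but in no child of `S`. -/
def ownCores (S : Finset V) : Finset (Finset V) :=
  W.K.filter fun C => C ⊆ S ∧ ∀ T ∈ W.children S, ¬ C ⊆ T

/-- What remains of a budget of 7 per core in `S`, minus 3, after paying for the edges of the
witness sets strictly inside `S`. -/
def innerSlack (S : Finset V) : ℤ :=
  7 * ((W.K.filter (· ⊆ S)).card : ℤ) - 3 - ∑ T ∈ W.L with T ⊂ S, (W.weight T : ℤ)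

/-- What remains of a budget of 7 per core in `S`, minus 3, after paying for the edges of the
witness sets inside `S`, the edge of `S` included. -/
def slack (S : Finset V) : ℤ :=
  7 * ((W.K.filter (· ⊆ S)).card : ℤ) - 3 - ∑ T ∈ W.L with T ⊆ S, (W.weight T : ℤ)

variable {W}

theorem core_eq {x : V} (hC : C ∈ W.K) (hD : D ∈ W.K) (hxC : x ∈ C) (hxD : x ∈ D) : C = D := by
  by_contra h
  exact Finset.disjoint_left.1 (W.core_disjoint C hC D hD h) hxC hxD

theorem weight_le_two (S : Finset V) : W.weight S ≤ 2 := by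
  have hsub : (W.K.filter fun C => ¬ (W.lo S ∈ C ↔ W.up S ∈ C)) ⊆
      (W.K.filter fun C => W.lo S ∈ C) ∪ (W.K.filter fun C => W.up S ∈ C) := by
    intro C hC
    simp only [Finset.mem_filter, Finset.mem_union] at hC ⊢
    tauto
  have hone : ∀ x : V, (W.K.filter fun C => x ∈ C).card ≤ 1 := fun x =>
    Finset.card_le_one.2 fun C hC D hD => by
      rw [Finset.mem_filter] at hC hD
      exact core_eq hC.1 hD.1 hC.2 hD.2
  have := hone (W.lo S)
  have := hone (W.up S)
  exact (Finset.card_le_card hsub).trans ((Finset.card_union_le _ _).trans (by omega))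

theorem weight_le_one (h : ¬ W.Double S) : W.weight S ≤ 1 := by
  refine Finset.card_le_one.2 fun C hC D hD => ?_
  rw [Finset.mem_filter] at hC hD
  by_contra hne
  have h1 : ∀ x, x ∈ C → x ∈ D → False := fun x hx hx' => hne (core_eq hC.1 hD.1 hx hx')
  have h2 := h1 (W.lo S)
  have h3 := h1 (W.up S)
  have h4 : ¬ (W.lo S ∈ C ∧ W.up S ∈ D) := fun h' =>
    h ⟨C, hC.1, D, hD.1, hne, h'.1, h'.2⟩
  have h5 : ¬ (W.lo S ∈ D ∧ W.up S ∈ C) := fun h' =>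
    h ⟨D, hD.1, C, hC.1, Ne.symm hne, h'.1, h'.2⟩
  tauto

theorem up_mem_of_ssubset (hS : S ∈ W.L) (hT : T ∈ W.L) (h : S ⊂ T) : W.up S ∈ T :=
  (W.lo_mem_iff S hS T hT h.ne).1 (h.1 (W.lo_mem S hS))

theorem lo_notMem_of_ssubset (hS : S ∈ W.L) (hT : T ∈ W.L) (h : S ⊂ T) : W.lo T ∉ S := fun hl =>
  W.up_notMem T hT (h.1 ((W.lo_mem_iff T hT S hS h.ne').1 hl))

namespace Chain

/-- A core that crosses the child of a chain node fills the node and crosses it as well. -/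
theorem subset_union (h : W.Chain S P) (hS : S ∈ W.L) (hC : C ∈ W.K) (hne : (C ∩ S).Nonempty)
    (hsub : ¬ C ⊆ S) : P ⊆ S ∪ C ∧ ¬ C ⊆ P := by
  have hCP : ¬ C ⊆ P := fun hCP => hsub (h.2.2.2 C hC hCP)
  refine ⟨(W.gap S hS P h.1 h.2.1 C hC hne hCP).resolve_right ?_, hCP⟩
  rintro ⟨D, hD, hDP⟩
  obtain ⟨x, hx⟩ := W.core_nonempty D hD
  exact (Finset.mem_sdiff.1 (hDP hx)).2
    (h.2.2.2 D hD (hDP.trans Finset.sdiff_subset) hx)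

theorem not_subset (h : W.Chain S P) (hC : C ∈ W.K) {x : V} (hx : x ∈ C) (hxS : x ∉ S) :
    ¬ C ⊆ P := fun hCP => hxS (h.2.2.2 C hC hCP hx)

/-- No core crosses a witness set with two chain nodes above it: it would contain both ends of
the edge of the lower one, which then covers no core. -/
theorem subset_of_chain (h : W.Chain S P) (h' : W.Chain P Q) (hS : S ∈ W.L) (hC : C ∈ W.K)
    (hne : (C ∩ S).Nonempty) : C ⊆ S := by
  by_contra hsub
  obtain ⟨hP, hCP⟩ := h.subset_union hS hC hne hsub
  obtain ⟨hQ, -⟩ := h'.subset_union h.1 hC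
    (hne.mono (Finset.inter_subset_inter_left h.2.1.1)) hCP
  have hlo : W.lo P ∈ C := (Finset.mem_union.1 (hP (W.lo_mem P h.1))).resolve_left
    (lo_notMem_of_ssubset hS h.1 h.2.1)
  have hup : W.up P ∈ C := (Finset.mem_union.1 (hQ (up_mem_of_ssubset h.1 h'.1 h'.2.1))).resolve_left
    (W.up_notMem P h.1)
  obtain ⟨D, hD, hcov⟩ := W.covers_core P h.1
  by_cases hl : W.lo P ∈ D
  · obtain rfl := core_eq hC hD hlo hl
    tauto
  · have hu : W.up P ∈ D := by tauto
    obtain rfl := core_eq hC hD hup hu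
    tauto

/-- If three chain nodes follow above `S`, no core contains the upper end of the edge of `S`. -/
theorem up_notMem_core (h₁ : W.Chain S P) (h₂ : W.Chain P Q) (h₃ : W.Chain Q R) (hS : S ∈ W.L)
    (hC : C ∈ W.K) : W.up S ∉ C := fun hup => by
  have hn : (C ∩ P).Nonempty :=
    ⟨W.up S, Finset.mem_inter.2 ⟨hup, up_mem_of_ssubset hS h₁.1 h₁.2.1⟩⟩
  exact h₁.not_subset hC hup (W.up_notMem S hS) (h₂.subset_of_chain h₃ h₁.1 hC hn)

/-- Of four consecutive chain nodes, the edge of the lowest would cover no core. -/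
theorem not_four (h₁ : W.Chain S P) (h₂ : W.Chain P Q) (h₃ : W.Chain Q R) (h₄ : W.Chain R U)
    (hS : S ∈ W.L) : False := by
  obtain ⟨D, hD, hcov⟩ := W.covers_core P h₁.1
  have hup : W.up P ∉ D := h₂.up_notMem_core h₃ h₄ h₁.1 hD
  have hlo : W.lo P ∈ D := by tauto
  have hn : (D ∩ P).Nonempty := ⟨W.lo P, Finset.mem_inter.2 ⟨hlo, W.lo_mem P h₁.1⟩⟩
  exact h₁.not_subset hD hlo (lo_notMem_of_ssubset hS h₁.1 h₁.2.1)
    (h₂.subset_of_chain h₃ h₁.1 hD hn)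

/-- If the core at the lower end of the edge of `S` crosses `S` and the parent of `S` is a chain
node, then the upper end lies in the same core. -/
theorem not_double (h : W.Chain S P) (hS : S ∈ W.L)
    (hlo : ∀ C ∈ W.K, W.lo S ∈ C → ¬ C ⊆ S) : ¬ W.Double S := by
  rintro ⟨C, hC, D, hD, hne, hl, hu⟩
  obtain ⟨hP, -⟩ := h.subset_union hS hC ⟨W.lo S, Finset.mem_inter.2 ⟨hl, W.lo_mem S hS⟩⟩
    (hlo C hC hl)
  have hup : W.up S ∈ C := (Finset.mem_union.1 (hP (up_mem_of_ssubset hS h.1 h.2.1))).resolve_left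
    (W.up_notMem S hS)
  exact hne (core_eq hC hD hup hu)

end Chain

theorem mem_children : U ∈ W.children S ↔
    U ∈ W.L ∧ U ⊂ S ∧ ∀ T ∈ W.L, T ⊂ S → U ⊆ T → U = T := by
  simp [children]

theorem exists_child (hT : T ∈ W.L) (hTS : T ⊂ S) : ∃ U ∈ W.children S, T ⊆ U := by
  obtain ⟨U, hTU, hU⟩ := (W.L.filter (· ⊂ S)).exists_le_maximal
    (Finset.mem_filter.2 ⟨hT, hTS⟩)
  have hU' := Finset.mem_filter.1 hU.prop
  exact ⟨U, mem_children.2 ⟨hU'.1, hU'.2, fun R hR hRS h =>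
    le_antisymm h (hU.le_of_ge (Finset.mem_filter.2 ⟨hR, hRS⟩) h)⟩, hTU⟩

theorem children_disjoint (hU : U ∈ W.children S) (hT : T ∈ W.children S) (hne : U ≠ T) :
    Disjoint U T := by
  rw [mem_children] at hU hT
  rcases W.laminar U hU.1 T hT.1 with h | h | h
  · exact absurd (hU.2.2 T hT.1 hT.2.1 h) hne
  · exact absurd (hT.2.2 U hU.1 hU.2.1 h).symm hne
  · exact h

theorem child_eq {x : V} (hU : U ∈ W.children S) (hT : T ∈ W.children S) (hxU : x ∈ U)
    (hxT : x ∈ T) : U = T := by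
  by_contra h
  exact Finset.disjoint_left.1 (children_disjoint hU hT h) hxU hxT

theorem card_cores_subset (S : Finset V) :
    (W.K.filter (· ⊆ S)).card =
      (W.ownCores S).card + ∑ T ∈ W.children S, (W.K.filter (· ⊆ T)).card := by
  have hd : (W.children S : Set (Finset V)).PairwiseDisjoint fun T => W.K.filter (· ⊆ T) := by
    intro U hU T hT hne
    refine Finset.disjoint_left.2 fun C hC hC' => ?_
    rw [Finset.mem_filter] at hC hC'
    obtain ⟨x, hx⟩ := W.core_nonempty C hC.1
    exact hne (child_eq hU hT (hC.2 hx) (hC'.2 hx))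
  rw [← Finset.card_biUnion hd, ← Finset.card_union_of_disjoint]
  · congr 1
    ext C
    simp only [ownCores, Finset.mem_filter, Finset.mem_union, Finset.mem_biUnion]
    constructor
    · rintro ⟨h1, h2⟩
      by_cases h : ∃ T ∈ W.children S, C ⊆ T
      · obtain ⟨T, hT, hCT⟩ := h
        exact Or.inr ⟨T, hT, h1, hCT⟩
      · push Not at h
        exact Or.inl ⟨h1, h2, h⟩
    · rintro (⟨h1, h2, -⟩ | ⟨T, hT, h1, h2⟩)
      · exact ⟨h1, h2⟩
      · exact ⟨h1, h2.trans (mem_children.1 hT).2.1.1⟩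
  · refine Finset.disjoint_left.2 fun C hC hC' => ?_
    simp only [ownCores, Finset.mem_filter, Finset.mem_biUnion] at hC hC'
    obtain ⟨T, hT, -, h⟩ := hC'
    exact hC.2.2 T hT h

theorem sum_weight_ssubset (S : Finset V) :
    (∑ T ∈ W.L with T ⊂ S, (W.weight T : ℤ)) =
      ∑ U ∈ W.children S, ∑ T ∈ W.L with T ⊆ U, (W.weight T : ℤ) := by
  have hd : (W.children S : Set (Finset V)).PairwiseDisjoint fun U => W.L.filter (· ⊆ U) := by
    intro U hU T hT hne
    refine Finset.disjoint_left.2 fun C hC hC' => ?_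
    rw [Finset.mem_filter] at hC hC'
    have hx := W.lo_mem C hC.1
    exact hne (child_eq hU hT (hC.2 hx) (hC'.2 hx))
  rw [← Finset.sum_biUnion hd]
  congr 1
  ext T
  simp only [Finset.mem_filter, Finset.mem_biUnion]
  constructor
  · rintro ⟨h1, h2⟩
    obtain ⟨U, hU, hTU⟩ := exists_child h1 h2
    exact ⟨U, hU, h1, hTU⟩
  · rintro ⟨U, hU, h1, h2⟩
    exact ⟨h1, Finset.ssubset_of_subset_of_ssubset h2 (mem_children.1 hU).2.1⟩

/-- The recursion for the slack: a node gains 7 for each of its own cores and 3 for each child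
after the first. -/
theorem innerSlack_eq (S : Finset V) :
    W.innerSlack S = 7 * ((W.ownCores S).card : ℤ) + 3 * ((W.children S).card - 1) +
      ∑ T ∈ W.children S, W.slack T := by
  unfold innerSlack slack
  rw [card_cores_subset, sum_weight_ssubset]
  simp only [Finset.sum_sub_distrib, Finset.sum_const, ← Finset.mul_sum]
  push_cast
  ring

theorem slack_eq (hS : S ∈ W.L) : W.slack S = W.innerSlack S - W.weight S := by
  have : W.L.filter (· ⊆ S) = insert S (W.L.filter (· ⊂ S)) := by
    ext T
    simp only [Finset.mem_filter, Finset.mem_insert, Finset.ssubset_iff_subset_ne]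
    by_cases h : T = S
    · subst h; simp [hS]
    · simp [h]
  unfold slack innerSlack
  rw [this, Finset.sum_insert (by simp)]
  ring

/-- The lower bound on the slack of a witness set: one unit for each of up to three chain nodes
above it, and otherwise at least `-1`, where `-1` needs an edge between two cores. -/
structure SlackBound (W : WitnessForest V) (S : Finset V) : Prop where
  one : ∀ P, W.Chain S P → 1 ≤ W.slack S
  two : ∀ P Q, W.Chain S P → W.Chain P Q → 2 ≤ W.slack S
  three : ∀ P Q R, W.Chain S P → W.Chain P Q → W.Chain Q R → 3 ≤ W.slack S
  neg_one : -1 ≤ W.slack S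
  zero : ¬ W.CrossDouble S → 0 ≤ W.slack S

theorem neg_card_le_sum_slack (h : ∀ T ∈ W.children S, W.SlackBound T) :
    -((W.children S).card : ℤ) ≤ ∑ T ∈ W.children S, W.slack T := by
  have := Finset.card_nsmul_le_sum (W.children S) W.slack (-1) fun T hT => (h T hT).neg_one
  simpa using this

theorem slackBound_of_own (hS : S ∈ W.L) (hown : (W.ownCores S).Nonempty)
    (ih : ∀ T ∈ W.children S, W.SlackBound T) : W.SlackBound S := by
  have h1 := slack_eq hS
  rw [innerSlack_eq] at h1
  have h2 := neg_card_le_sum_slack ih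
  have h3 := Finset.card_pos.2 hown
  have h4 := weight_le_two (W := W) S
  refine ⟨fun _ _ => by omega, fun _ _ _ _ => by omega, fun P Q R hP hQ hR => ?_, by omega,
    fun _ => by omega⟩
  have h5 : W.weight S ≤ 1 := weight_le_one fun ⟨_, _, D, hD, _, _, hu⟩ =>
    hP.up_notMem_core hQ hR hS hD hu
  omega

theorem not_subset_of_lo_mem (hS : S ∈ W.L) (hown : W.ownCores S = ∅) (hC : C ∈ W.K)
    (hlo : W.lo S ∈ C) : ¬ C ⊆ S := fun hCS => by
  have : C ∉ W.ownCores S := by simp [hown]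
  simp only [ownCores, Finset.mem_filter, not_and, not_forall, not_not] at this
  obtain ⟨T, hT, hCT⟩ := this hC hCS
  rw [mem_children] at hT
  exact lo_notMem_of_ssubset hT.1 hS hT.2.1 (hCT hlo)

theorem exists_child_of_core (hown : W.ownCores S = ∅) (hC : C ∈ W.K) (hCS : C ⊆ S) :
    ∃ T ∈ W.children S, C ⊆ T := by
  have : C ∉ W.ownCores S := by simp [hown]
  simp only [ownCores, Finset.mem_filter, not_and, not_forall, not_not] at this
  obtain ⟨T, hT, hCT⟩ := this hC hCS
  exact ⟨T, hT, hCT⟩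

theorem weight_le_one_of_not_crossDouble (hS : S ∈ W.L) (hown : W.ownCores S = ∅)
    (h : ¬ W.CrossDouble S) : W.weight S ≤ 1 :=
  weight_le_one fun ⟨C, hC, D, hD, hne, hl, hu⟩ =>
    h ⟨C, hC, D, hD, hne, hl, hu, not_subset_of_lo_mem hS hown hC hl⟩

theorem slackBound_of_child (hS : S ∈ W.L) (hown : W.ownCores S = ∅)
    (hT : W.children S = {T}) (ih : W.SlackBound T) : W.SlackBound S := by
  have hTc : T ∈ W.children S := by simp [hT]
  have hTL := (mem_children.1 hTc).1
  have hch : W.Chain T S := by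
    refine ⟨hS, (mem_children.1 hTc).2.1, fun U hU hUS => ?_, fun C hC hCS => ?_⟩
    · obtain ⟨R, hR, h⟩ := exists_child hU hUS
      rw [hT, Finset.mem_singleton] at hR
      exact hR ▸ h
    · obtain ⟨R, hR, h⟩ := exists_child_of_core hown hC hCS
      rw [hT, Finset.mem_singleton] at hR
      exact hR ▸ h
  have h1 := slack_eq hS
  rw [innerSlack_eq, hown, hT] at h1
  simp only [Finset.card_empty, Finset.card_singleton, Finset.sum_singleton] at h1
  have h2 := ih.one S hch
  have hw : ∀ P, W.Chain S P → W.weight S ≤ 1 := fun P hP =>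
    weight_le_one (hP.not_double hS fun C hC => not_subset_of_lo_mem hS hown hC)
  have hw2 := weight_le_two (W := W) S
  refine ⟨fun P hP => ?_, fun P Q hP hQ => ?_,
    fun P Q R hP hQ hR => (hch.not_four hP hQ hR hTL).elim, by omega, fun h => ?_⟩
  · have := hw P hP
    have := ih.two S P hch hP
    omega
  · have := hw P hP
    have := ih.three S P Q hch hP hQ
    omega
  · have := weight_le_one_of_not_crossDouble hS hown h
    omega

/-- If the edge of a child of `S` joins two cores that are not contained in `S`, both cores
would fill a chain node above `S`, so there is none. -/
theorem not_chain_of_crossDouble_child (hS : S ∈ W.L) (hown : W.ownCores S = ∅)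
    (hT : T ∈ W.children S) (h : W.CrossDouble T) (hP : W.Chain S P) : False := by
  obtain ⟨C, hC, D, hD, hne, hl, hu, hCT⟩ := h
  have hT' := mem_children.1 hT
  have hlT := W.lo_mem T hT'.1
  have hupS := up_mem_of_ssubset hT'.1 hS hT'.2.1
  have hCS : ¬ C ⊆ S := fun h => by
    obtain ⟨U, hU, hCU⟩ := exists_child_of_core hown hC h
    exact hCT (child_eq hU hT (hCU hl) hlT ▸ hCU)
  have hDS : ¬ D ⊆ S := fun h => by
    obtain ⟨U, hU, hDU⟩ := exists_child_of_core hown hD h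
    have hUT : T ≠ U := by
      rintro rfl
      exact W.up_notMem T hT'.1 (hDU hu)
    exact hUT (child_eq hT hU hlT
      ((W.lo_mem_iff T hT'.1 U (mem_children.1 hU).1 hUT).2 (hDU hu)))
  have h1 := (hP.subset_union hS hC ⟨_, Finset.mem_inter.2 ⟨hl, hT'.2.1.1 hlT⟩⟩ hCS).1
  have h2 := (hP.subset_union hS hD ⟨_, Finset.mem_inter.2 ⟨hu, hupS⟩⟩ hDS).1
  have hup := up_mem_of_ssubset hS hP.1 hP.2.1
  have hn := W.up_notMem S hS
  exact hne (core_eq hC hD ((Finset.mem_union.1 (h1 hup)).resolve_left hn)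
    ((Finset.mem_union.1 (h2 hup)).resolve_left hn))

theorem slackBound_of_branching (hS : S ∈ W.L) (hown : W.ownCores S = ∅)
    (hr : 2 ≤ (W.children S).card) (ih : ∀ T ∈ W.children S, W.SlackBound T) :
    W.SlackBound S := by
  have h1 := slack_eq hS
  rw [innerSlack_eq, hown, Finset.card_empty] at h1
  have hw : ∀ P, W.Chain S P → W.weight S ≤ 1 := fun P hP =>
    weight_le_one (hP.not_double hS fun C hC => not_subset_of_lo_mem hS hown hC)
  have hw1 := weight_le_one_of_not_crossDouble hS hown
  have hw2 := weight_le_two (W := W) S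
  by_cases hD : ∃ T ∈ W.children S, W.CrossDouble T
  · obtain ⟨T, hT, hD⟩ := hD
    have hno : ∀ P, ¬ W.Chain S P := fun P => not_chain_of_crossDouble_child hS hown hT hD
    have h2 := neg_card_le_sum_slack ih
    refine ⟨fun P hP => (hno P hP).elim, fun P _ hP => (hno P hP).elim,
      fun P _ _ hP => (hno P hP).elim, by omega, fun h => ?_⟩
    have := hw1 h
    omega
  · push Not at hD
    have h2 : 0 ≤ ∑ T ∈ W.children S, W.slack T :=
      Finset.sum_nonneg fun T hT => (ih T hT).zero (hD T hT)
    refine ⟨fun P hP => by omega, fun P Q hP hQ => ?_, fun P Q R hP hQ hR => ?_, by omega,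
      fun h => by omega⟩
    · have := hw P hP
      omega
    · obtain ⟨C, hC, hcov⟩ := W.covers_core S hS
      have hup := hP.up_notMem_core hQ hR hS hC
      have hlo : W.lo S ∈ C := by tauto
      exact (not_subset_of_lo_mem hS hown hC hlo (hP.subset_of_chain hQ hS hC
        ⟨_, Finset.mem_inter.2 ⟨hlo, W.lo_mem S hS⟩⟩)).elim

theorem slackBound (S : Finset V) (hS : S ∈ W.L) : W.SlackBound S := by
  induction S using Finset.strongInduction with
  | H S ih =>
    have ih' : ∀ T ∈ W.children S, W.SlackBound T := fun T hT =>
      ih T (mem_children.1 hT).2.1 (mem_children.1 hT).1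
    rcases (W.ownCores S).eq_empty_or_nonempty with hown | hown
    · obtain ⟨C, hC, hCS⟩ := W.exists_core S hS
      obtain ⟨T, hT, -⟩ := exists_child_of_core hown hC hCS
      have hpos : 0 < (W.children S).card := Finset.card_pos.2 ⟨T, hT⟩
      rcases Nat.lt_or_ge (W.children S).card 2 with h | h
      · obtain ⟨U, hU⟩ := Finset.card_eq_one.1 (by omega : (W.children S).card = 1)
        exact slackBound_of_child hS hown hU (ih' U (by simp [hU]))
      · exact slackBound_of_branching hS hown h ih'
    · exact slackBound_of_own hS hown ih'

theorem sum_weight_le [Fintype V] : ∑ S ∈ W.L, W.weight S ≤ 7 * W.K.card := by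
  have h1 := innerSlack_eq (W := W) Finset.univ
  have h2 := neg_card_le_sum_slack (W := W) (S := Finset.univ) fun T hT =>
    slackBound T (mem_children.1 hT).1
  have h3 : W.L.filter (· ⊂ Finset.univ) = W.L := Finset.filter_true_of_mem fun S hS =>
    Finset.ssubset_univ_iff.2 fun h => W.up_notMem S hS (h ▸ Finset.mem_univ _)
  have h4 : W.K.filter (· ⊆ Finset.univ) = W.K :=
    Finset.filter_true_of_mem fun _ _ => Finset.subset_univ _
  rw [innerSlack, h3, h4] at h1
  zify
  omega

end WitnessForest

/-! ### Laminar families of witness sets -/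

/-- `A` and `B` are nested or disjoint. -/
def Uncrossed {V : Type*} (A B : Finset V) : Prop := A ⊆ B ∨ B ⊆ A ∨ Disjoint A B

theorem Uncrossed.symm {V : Type*} {A B : Finset V} (h : Uncrossed A B) : Uncrossed B A := by
  rcases h with h | h | h
  · exact Or.inr (Or.inl h)
  · exact Or.inl h
  · exact Or.inr (Or.inr h.symm)

section Laminar

variable {V E : Type*} [DecidableEq V] {G : Multigraph V E} {F : Finset (Finset V)}
  {A B S T X Z : Finset V} {I : Finset E} {e f : E}

/-- `S` is a member of `F` that is covered by `e` and by no other edge of `I`. -/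
def IsWitness (G : Multigraph V E) (F : Finset (Finset V)) (I : Finset E) (e : E)
    (S : Finset V) : Prop :=
  S ∈ F ∧ ∀ g ∈ I, G.Covers g S ↔ g = e

/-- `Z` is one of the four sets that uncrossing `A` and `B` produces. -/
def IsCorner (A B Z : Finset V) : Prop := Z = A ∩ B ∨ Z = A ∪ B ∨ Z = A \ B ∨ Z = B \ A

theorem Uncrossed.of_corner (hAB : ¬ Uncrossed A B) (hA : Uncrossed X A) (hB : Uncrossed X B)
    (hZ : IsCorner A B Z) : Uncrossed X Z := by
  unfold Uncrossed at *
  simp only [Finset.subset_iff, Finset.disjoint_left] at *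
  rcases hZ with rfl | rfl | rfl | rfl <;> simp only [Finset.mem_inter, Finset.mem_union,
    Finset.mem_sdiff] <;> grind

theorem IsCorner.uncrossed_left (hZ : IsCorner A B Z) : Uncrossed A Z := by
  unfold Uncrossed
  simp only [Finset.subset_iff, Finset.disjoint_left]
  rcases hZ with rfl | rfl | rfl | rfl <;> simp only [Finset.mem_inter, Finset.mem_union,
    Finset.mem_sdiff] <;> grind

theorem IsCorner.uncrossed_right (hZ : IsCorner A B Z) : Uncrossed B Z := by
  unfold Uncrossed
  simp only [Finset.subset_iff, Finset.disjoint_left]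
  rcases hZ with rfl | rfl | rfl | rfl <;> simp only [Finset.mem_inter, Finset.mem_union,
    Finset.mem_sdiff] <;> grind

theorem IsCorner.not_covers (hZ : IsCorner A B Z) {g : E} (hA : ¬ G.Covers g A)
    (hB : ¬ G.Covers g B) : ¬ G.Covers g Z := by
  rw [Multigraph.covers_iff, not_not] at *
  rcases hZ with rfl | rfl | rfl | rfl <;> simp [hA, hB]

theorem IsCorner.isWitness_right (hZ : IsCorner A B Z) (hA : IsWitness G F I e A)
    (hB : IsWitness G F I f B) (hZF : Z ∈ F) (hf : G.Covers f Z) (he : ¬ G.Covers e Z) :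
    IsWitness G F I f Z := by
  refine ⟨hZF, fun g hg => ⟨fun h => ?_, fun h => h ▸ hf⟩⟩
  by_contra hgf
  have hge : g ≠ e := fun h' => he (h' ▸ h)
  exact hZ.not_covers (fun h' => hge ((hA.2 g hg).1 h')) (fun h' => hgf ((hB.2 g hg).1 h')) h

theorem IsCorner.isWitness_left (hZ : IsCorner A B Z) (hA : IsWitness G F I e A)
    (hB : IsWitness G F I f B) (hZF : Z ∈ F) (hf : ¬ G.Covers f Z) (he : G.Covers e Z) :
    IsWitness G F I e Z := by
  refine ⟨hZF, fun g hg => ⟨fun h => ?_, fun h => h ▸ he⟩⟩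
  by_contra hge
  have hgf : g ≠ f := fun h' => hf (h' ▸ h)
  exact hZ.not_covers (fun h' => hge ((hA.2 g hg).1 h')) (fun h' => hgf ((hB.2 g hg).1 h')) h

theorem IsCorner.notMem (hZ : IsCorner A B Z) (hI : G.IsCover F I) (hA : IsWitness G F I e A)
    (hB : IsWitness G F I f B) (hf : ¬ G.Covers f Z) (he : ¬ G.Covers e Z) : Z ∉ F := fun hZF => by
  obtain ⟨g, hg, hc⟩ := Multigraph.isCover_iff.1 hI Z hZF
  exact hZ.not_covers (fun h' => he ((hA.2 g hg).1 h' ▸ hc))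
    (fun h' => hf ((hB.2 g hg).1 h' ▸ hc)) hc

variable [Fintype V]

set_option linter.unusedSimpArgs false in
/-- Uncrossing the witness sets `A` and `B` of two edges `e` and `f`: one of the four corners is
again a witness set. If it is one for `e`, it lies on the side of `A` that does not contain
`f`. -/
theorem exists_corner_isWitness (hF : Pliable F) (hI : G.IsCover F I) (he : e ∈ I) (hf : f ∈ I)
    (hef : e ≠ f) (hA : IsWitness G F I e A) (hB : IsWitness G F I f B) :
    ∃ Z, IsCorner A B Z ∧ (IsWitness G F I f Z ∨ IsWitness G F I e Z ∧
      if (G.ends f).1 ∈ A then A ⊆ Z ∨ Disjoint A Z else Z ⊆ A) := by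
  have heA := (hA.2 e he).2 rfl
  have hfA := mt (hA.2 f hf).1 hef.symm
  have heB := mt (hB.2 e he).1 hef
  have hfB := (hB.2 f hf).2 rfl
  have c₁ : IsCorner A B (A ∩ B) := Or.inl rfl
  have c₂ : IsCorner A B (A ∪ B) := Or.inr (Or.inl rfl)
  have c₃ : IsCorner A B (A \ B) := Or.inr (Or.inr (Or.inl rfl))
  have c₄ : IsCorner A B (B \ A) := Or.inr (Or.inr (Or.inr rfl))
  have hc := hF.corners hA.1 hB.1
  have key₁ := fun Z (h : IsCorner A B Z) => h.isWitness_right hA hB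
  have key₂ := fun Z (h : IsCorner A B Z) => h.isWitness_left hA hB
  have key₃ := fun Z (h : IsCorner A B Z) => h.notMem hI hA hB
  simp only [Multigraph.covers_iff] at heA hfA heB hfB key₁ key₂ key₃
  replace heA : (G.ends e).2 ∈ A ↔ (G.ends e).1 ∉ A := (not_iff.1 heA).symm
  replace hfA : (G.ends f).2 ∈ A ↔ (G.ends f).1 ∈ A := (not_not.1 hfA).symm
  replace heB : (G.ends e).2 ∈ B ↔ (G.ends e).1 ∈ B := (not_not.1 heB).symm
  replace hfB : (G.ends f).2 ∈ B ↔ (G.ends f).1 ∉ B := (not_iff.1 hfB).symm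
  -- The end `e.1` lies in `B` or not, and `f.1` lies in `A` or not; in each case one corner is
  -- covered by neither edge, hence not in `F`, so that of the two corners that exactly one of the
  -- edges covers, at least one is in `F`.
  by_cases h1 : (G.ends e).1 ∈ B <;> by_cases h2 : (G.ends f).1 ∈ A
  · have h3 := key₃ _ c₂ (by simp [heA, hfA, heB, hfB, h1, h2]) (by simp [heA, hfA, heB, hfB, h1, h2])
    rcases hc.2.2.2.resolve_left h3 with h | h
    · exact ⟨_, c₃, Or.inl (key₁ _ c₃ h (by simp [heA, hfA, heB, hfB, h1, h2]) (by simp [heA, hfA, heB, hfB, h1, h2]))⟩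
    · refine ⟨_, c₄, Or.inr ⟨key₂ _ c₄ h (by simp [heA, hfA, heB, hfB, h1, h2]) (by simp [heA, hfA, heB, hfB, h1, h2]), ?_⟩⟩
      rw [if_pos h2]
      exact Or.inr Finset.disjoint_sdiff
  · have h3 := key₃ _ c₃ (by simp [heA, hfA, heB, hfB, h1, h2]) (by simp [heA, hfA, heB, hfB, h1, h2])
    have h4 := hc.1
    simp only [h3, or_false] at h4
    rcases h4.symm with h | h
    · exact ⟨_, c₂, Or.inl (key₁ _ c₂ h (by simp [heA, hfA, heB, hfB, h1, h2]) (by simp [heA, hfA, heB, hfB, h1, h2]))⟩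
    · refine ⟨_, c₁, Or.inr ⟨key₂ _ c₁ h (by simp [heA, hfA, heB, hfB, h1, h2]) (by simp [heA, hfA, heB, hfB, h1, h2]), ?_⟩⟩
      rw [if_neg h2]
      exact Finset.inter_subset_left
  · have h3 := key₃ _ c₄ (by simp [heA, hfA, heB, hfB, h1, h2]) (by simp [heA, hfA, heB, hfB, h1, h2])
    have h4 := hc.2.1
    simp only [h3, or_false] at h4
    rcases h4 with h | h
    · exact ⟨_, c₁, Or.inl (key₁ _ c₁ h (by simp [heA, hfA, heB, hfB, h1, h2]) (by simp [heA, hfA, heB, hfB, h1, h2]))⟩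
    · refine ⟨_, c₂, Or.inr ⟨key₂ _ c₂ h (by simp [heA, hfA, heB, hfB, h1, h2]) (by simp [heA, hfA, heB, hfB, h1, h2]), ?_⟩⟩
      rw [if_pos h2]
      exact Or.inl Finset.subset_union_left
  · have h3 := key₃ _ c₁ (by simp [heA, hfA, heB, hfB, h1, h2]) (by simp [heA, hfA, heB, hfB, h1, h2])
    rcases (hc.2.2.1.resolve_left h3).symm with h | h
    · exact ⟨_, c₄, Or.inl (key₁ _ c₄ h (by simp [heA, hfA, heB, hfB, h1, h2]) (by simp [heA, hfA, heB, hfB, h1, h2]))⟩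
    · refine ⟨_, c₃, Or.inr ⟨key₂ _ c₃ h (by simp [heA, hfA, heB, hfB, h1, h2]) (by simp [heA, hfA, heB, hfB, h1, h2]), ?_⟩⟩
      rw [if_neg h2]
      exact Finset.sdiff_subset

/-- `W` assigns to the edges in `s` witness sets that form a laminar family. -/
def IsLaminarWitness (G : Multigraph V E) (F : Finset (Finset V)) (I s : Finset E)
    (W : E → Finset V) : Prop :=
  (∀ e ∈ s, IsWitness G F I e (W e)) ∧ ∀ e ∈ s, ∀ g ∈ s, Uncrossed (W e) (W g)

open Classical in
/-- A laminar family of witness sets is extended by a witness set of one more edge, by induction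
on the number of members that the new set crosses. -/
theorem IsLaminarWitness.extend [DecidableEq E] (hF : Pliable F) (hI : G.IsCover F I)
    {s : Finset E} (hs : s ⊆ I) (hf : f ∈ I) (hfs : f ∉ s) (n : ℕ) :
    ∀ (W : E → Finset V) (B : Finset V), IsLaminarWitness G F I s W → IsWitness G F I f B →
      (s.filter fun e => ¬ Uncrossed (W e) B).card = n →
      ∃ W', IsLaminarWitness G F I (insert f s) W' := by
  induction n using Nat.strong_induction_on with
  | _ n ih =>
  intro W B hW hB hn
  by_cases hX : ∃ e ∈ s, ¬ Uncrossed (W e) B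
  swap
  · push Not at hX
    have hne : ∀ e ∈ s, e ≠ f := fun e he h => hfs (h ▸ he)
    refine ⟨Function.update W f B, fun e he => ?_, fun e he g hg => ?_⟩
    · rcases Finset.mem_insert.1 he with rfl | he
      · simpa using hB
      · simpa [hne e he] using hW.1 e he
    · rcases Finset.mem_insert.1 he with he | he <;> rcases Finset.mem_insert.1 hg with hg | hg
      · rw [he, hg]
        exact Or.inl subset_rfl
      · simpa [he, hne g hg] using (hX g hg).symm
      · simpa [hg, hne e he] using hX e he
      · simpa [hne e he, hne g hg] using hW.2 e he g hg
  -- The set `W e` to be uncrossed with `B` is extremal: whatever else `B` crosses does not lie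
  -- properly on the side of `W e` that does not contain the edge `f`.
  obtain ⟨e, he, heB, hext⟩ : ∃ e ∈ s, ¬ Uncrossed (W e) B ∧
      ∀ g ∈ s, ¬ Uncrossed (W g) B →
        if (G.ends f).1 ∈ W e then W g ⊆ W e else W g ⊆ W e → W g = W e := by
    by_cases hout : ∃ e ∈ s, ¬ Uncrossed (W e) B ∧ (G.ends f).1 ∉ W e
    · obtain ⟨e₀, he₀⟩ := hout
      obtain ⟨e, he, hmin⟩ := (s.filter fun e => ¬ Uncrossed (W e) B ∧
        (G.ends f).1 ∉ W e).exists_min_image (fun e => (W e).card)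
          ⟨e₀, Finset.mem_filter.2 he₀⟩
      rw [Finset.mem_filter] at he
      refine ⟨e, he.1, he.2.1, fun g hg hgB => ?_⟩
      rw [if_neg he.2.2]
      exact fun hsub => Finset.eq_of_subset_of_card_le hsub
        (hmin g (Finset.mem_filter.2 ⟨hg, hgB, fun h => he.2.2 (hsub h)⟩))
    · push Not at hout
      obtain ⟨e₀, he₀⟩ := hX
      obtain ⟨e, he, hmax⟩ := (s.filter fun e => ¬ Uncrossed (W e) B).exists_max_image
        (fun e => (W e).card) ⟨e₀, Finset.mem_filter.2 he₀⟩
      rw [Finset.mem_filter] at he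
      refine ⟨e, he.1, he.2, fun g hg hgB => ?_⟩
      have h1 := hout e he.1 he.2
      rw [if_pos h1]
      rcases hW.2 g hg e he.1 with h | h | h
      · exact h
      · exact (Finset.eq_of_subset_of_card_le h
          (hmax g (Finset.mem_filter.2 ⟨hg, hgB⟩))).ge
      · exact (Finset.disjoint_left.1 h (hout g hg hgB) h1).elim
  have hef : e ≠ f := fun h => hfs (h ▸ he)
  obtain ⟨Z, hZ, hZw⟩ := exists_corner_isWitness hF hI (hs he) hf hef (hW.1 e he) hB
  rcases hZw with hZw | ⟨hZw, hside⟩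
  · refine ih _ ?_ W Z hW hZw rfl
    rw [← hn]
    refine Finset.card_lt_card ((Finset.ssubset_iff_of_subset fun g hg => ?_).2
      ⟨e, Finset.mem_filter.2 ⟨he, heB⟩, fun h => (Finset.mem_filter.1 h).2 hZ.uncrossed_left⟩)
    rw [Finset.mem_filter] at hg ⊢
    exact ⟨hg.1, fun h => hg.2 (Uncrossed.of_corner heB (hW.2 g hg.1 e he) h hZ)⟩
  · have hother : ∀ g ∈ s, Uncrossed (W g) Z := by
      intro g hg
      by_cases hgB : Uncrossed (W g) B
      · exact Uncrossed.of_corner heB (hW.2 g hg e he) hgB hZ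
      have h1 := hext g hg hgB
      by_cases h2 : (G.ends f).1 ∈ W e
      · rw [if_pos h2] at h1 hside
        rcases hside with h | h
        · exact Or.inl (h1.trans h)
        · exact Or.inr (Or.inr (Finset.disjoint_of_subset_left h1 h))
      · rw [if_neg h2] at h1 hside
        rcases hW.2 g hg e he with h | h | h
        · rw [h1 h]
          exact Or.inr (Or.inl hside)
        · exact Or.inr (Or.inl (hside.trans h))
        · exact Or.inr (Or.inr (Finset.disjoint_of_subset_right hside h))
    refine ih _ ?_ (Function.update W e Z) B ⟨fun g hg => ?_, fun g hg g' hg' => ?_⟩ hB rfl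
    · rw [← hn]
      refine Finset.card_lt_card ((Finset.ssubset_iff_of_subset fun g hg => ?_).2
        ⟨e, Finset.mem_filter.2 ⟨he, heB⟩, fun h => (Finset.mem_filter.1 h).2 ?_⟩)
      · rw [Finset.mem_filter] at hg ⊢
        refine ⟨hg.1, fun h => hg.2 ?_⟩
        by_cases hge : g = e
        · subst hge
          exact (heB h).elim
        · simpa [hge] using h
      · simpa using hZ.uncrossed_right.symm
    · by_cases hge : g = e
      · subst hge
        simpa using hZw
      · simpa [hge] using hW.1 g hg
    · by_cases hge : g = e <;> by_cases hge' : g' = e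
      · simp only [hge, hge']
        exact Or.inl subset_rfl
      · simpa [hge, hge'] using (hother g' hg').symm
      · simpa [hge, hge'] using hother g hg
      · simpa [hge, hge'] using hW.2 g hg g' hg'

theorem exists_isLaminarWitness [DecidableEq E] (hF : Pliable F) (hI : G.IsCover F I)
    (hw : ∀ e ∈ I, ∃ S, IsWitness G F I e S) : ∃ W, IsLaminarWitness G F I I W := by
  suffices h : ∀ s ⊆ I, ∃ W, IsLaminarWitness G F I s W from h I subset_rfl
  intro s
  induction s using Finset.induction_on with
  | empty => exact fun _ => ⟨fun _ => ∅, by simp [IsLaminarWitness]⟩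
  | insert f s hfs ih =>
    intro hs
    rw [Finset.insert_subset_iff] at hs
    obtain ⟨W, hW⟩ := ih hs.2
    obtain ⟨B, hB⟩ := hw f hs.1
    exact hW.extend hF hI hs.2 hs.1 hfs _ W B hB rfl

end Laminar

/-! ### The bound on the degrees of the cores -/

section DegreeBound

variable {V E : Type*} [DecidableEq V] [DecidableEq E] {G : Multigraph V E}
  {F : Finset (Finset V)} {I J : Finset E}

theorem minimal_isCover_iff :
    Minimal (G.IsCover F) I ↔ G.IsCover F I ∧ ∀ e ∈ I, ¬ G.IsCover F (I.erase e) := by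
  refine ⟨fun h => ⟨h.prop, fun e he hc => ?_⟩, fun h => ⟨h.1, fun J hJ hJI e he => ?_⟩⟩
  · exact Finset.notMem_erase e I (h.le_of_le hc (Finset.erase_subset e I) he)
  · by_contra heJ
    exact h.2 e he (hJ.mono fun x hx => Finset.mem_erase.2 ⟨fun h' => heJ (h' ▸ hx), hJI hx⟩)

theorem exists_isWitness (h : Minimal (G.IsCover F) I) {e : E} (he : e ∈ I) :
    ∃ S, IsWitness G F I e S := by
  rw [minimal_isCover_iff, Multigraph.isCover_iff] at h
  have h1 := h.2 e he
  rw [Multigraph.isCover_iff] at h1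
  push Not at h1
  obtain ⟨S, hS, hn⟩ := h1
  have hg : ∀ g ∈ I, G.Covers g S → g = e := fun g hg hc => by
    by_contra hne
    exact hn g (Finset.mem_erase.2 ⟨hne, hg⟩) hc
  obtain ⟨f, hf, hfS⟩ := h.1 S hS
  refine ⟨S, hS, fun g hgI => ⟨hg g hgI, fun h' => ?_⟩⟩
  rw [h', ← hg f hf hfS]
  exact hfS

variable [Fintype V]

/-- A minimal cover whose edges all cover a core gives rise to a forest of witness sets, in which
the weights add up to the sum of the degrees of the cores. -/
theorem exists_witnessForest (hF : GammaPliable G F) (hI : Minimal (G.IsCover F) I)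
    (hcore : ∀ e ∈ I, ∃ C ∈ cores F, G.Covers e C) (hne : I.Nonempty) :
    ∃ W : WitnessForest V, W.K = cores F ∧
      ∑ C ∈ cores F, G.deg I C = ∑ S ∈ W.L, W.weight S := by
  obtain ⟨W, hW, hlam⟩ := exists_isLaminarWitness hF.1 hI.prop fun e he => exists_isWitness hI he
  have : Nonempty E := ⟨hne.choose⟩
  have hinj : Set.InjOn W I := fun e he f hf h => by
    have := ((hW e he).2 e he).2 rfl
    rw [h] at this
    exact ((hW f hf).2 e he).1 this
  -- the edge of a witness set, and the end of it inside or outside the set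
  let ed : Finset V → E := Function.invFunOn W I
  have hed : ∀ e ∈ I, ed (W e) = e := fun e he => hinj.leftInvOn_invFunOn he
  let lo : Finset V → V := fun S =>
    if (G.ends (ed S)).1 ∈ S then (G.ends (ed S)).1 else (G.ends (ed S)).2
  let up : Finset V → V := fun S =>
    if (G.ends (ed S)).1 ∈ S then (G.ends (ed S)).2 else (G.ends (ed S)).1
  have hlu : ∀ S T, (lo S ∈ T ↔ up S ∈ T) ↔ ¬ G.Covers (ed S) T := by
    intro S T
    rw [Multigraph.covers_iff, not_not]
    by_cases h : (G.ends (ed S)).1 ∈ S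
    · simp only [lo, up, if_pos h]
    · simp only [lo, up, if_neg h]
      exact Iff.comm
  have hown : ∀ e ∈ I, lo (W e) ∈ W e ∧ up (W e) ∉ W e := by
    intro e he
    have h := ((hW e he).2 e he).2 rfl
    rw [Multigraph.covers_iff] at h
    by_cases h1 : (G.ends e).1 ∈ W e
    · simp only [lo, up, hed e he, if_pos h1]
      tauto
    · simp only [lo, up, hed e he, if_neg h1]
      tauto
  let T : WitnessForest V :=
    { L := I.image W
      K := cores F
      lo := lo
      up := up
      laminar := by
        simp only [Finset.forall_mem_image]
        exact fun e he g hg => hlam e he g hg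
      lo_mem := by
        simp only [Finset.forall_mem_image]
        exact fun e he => (hown e he).1
      up_notMem := by
        simp only [Finset.forall_mem_image]
        exact fun e he => (hown e he).2
      lo_mem_iff := by
        simp only [Finset.forall_mem_image]
        intro e he g hg hne
        rw [hlu, hed e he, (hW g hg).2 e he]
        exact fun h => hne (h ▸ rfl)
      core_nonempty := fun C hC => hF.1.nonempty (mem_cores.1 hC).1
      core_disjoint := fun C hC D hD => hF.1.disjoint_cores hC hD
      exists_core := by
        simp only [Finset.forall_mem_image]
        exact fun e he => exists_core_subset (hW e he).1
      gap := by
        simp only [Finset.forall_mem_image]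
        intro e he g hg hsub C hC hCn hCs
        have hres : G.residual F ∅ = F := by
          ext S
          simp [Multigraph.mem_residual]
        have h := hF.2 ∅
        rw [hres] at h
        have hx := h _ (hW e he).1 _ (hW g hg).1 hsub C hC
          (hF.1.cross_of_mem_cores hC (hW e he).1 hCn fun h' => hCs (h'.trans hsub.1))
          (hF.1.cross_of_mem_cores hC (hW g hg).1
            (hCn.mono (Finset.inter_subset_inter_left hsub.1)) hCs)
        refine hx.imp Finset.sdiff_eq_empty_iff_subset.1 fun h' => ?_
        obtain ⟨D, hD, hDs⟩ := exists_core_subset h'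
        exact ⟨D, hD, hDs.trans (Finset.sdiff_subset_sdiff subset_rfl Finset.subset_union_left)⟩
      covers_core := by
        simp only [Finset.forall_mem_image]
        intro e he
        obtain ⟨C, hC, hc⟩ := hcore e he
        refine ⟨C, hC, ?_⟩
        rw [hlu, hed e he, not_not]
        exact hc }
  refine ⟨T, rfl, ?_⟩
  change _ = ∑ S ∈ I.image W, T.weight S
  rw [Finset.sum_image hinj]
  simp only [Multigraph.deg, Finset.card_filter]
  rw [Finset.sum_comm]
  refine Finset.sum_congr rfl fun e he => ?_
  rw [← Finset.card_filter]
  refine congrArg Finset.card (Finset.filter_congr fun C _ => ?_)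
  change _ ↔ ¬ (lo (W e) ∈ C ↔ up (W e) ∈ C)
  rw [hlu, hed e he, not_not]

theorem sum_deg_cores_le_of_covers_core (hF : GammaPliable G F) (hI : Minimal (G.IsCover F) I)
    (hcore : ∀ e ∈ I, ∃ C ∈ cores F, G.Covers e C) :
    ∑ C ∈ cores F, G.deg I C ≤ 7 * (cores F).card := by
  rcases I.eq_empty_or_nonempty with rfl | hne
  · simp [Multigraph.deg]
  · obtain ⟨W, hK, hW⟩ := exists_witnessForest hF hI hcore hne
    rw [hW, ← hK]
    exact WitnessForest.sum_weight_le

/-- The degree bound for an arbitrary minimal cover. The edges that cover no core are dropped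
from it, and the sets that they cover from the family: the cores remain the same. -/
theorem sum_deg_cores_le (hF : GammaPliable G F) (hI : Minimal (G.IsCover F) I) :
    ∑ C ∈ cores F, G.deg I C ≤ 7 * (cores F).card := by
  set I' := I.filter fun e => ∃ C ∈ cores F, G.Covers e C with hI'
  set K := I.filter fun e => ¬ ∃ C ∈ cores F, G.Covers e C with hK
  have hmem : ∀ C ∈ cores F, C ∈ G.residual F K := fun C hC =>
    Multigraph.mem_residual.2 ⟨(mem_cores.1 hC).1, fun e he hc =>
      (Finset.mem_filter.1 he).2 ⟨C, hC, hc⟩⟩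
  have hcores : cores (G.residual F K) = cores F := by
    ext C
    constructor
    · intro hC
      rw [mem_cores] at hC
      obtain ⟨D, hD, hDC⟩ := exists_core_subset (Multigraph.mem_residual.1 hC.1).1
      rwa [← hC.2 D (hmem D hD) hDC]
    · exact fun hC => mem_cores.2 ⟨hmem C hC, fun S hS =>
        (mem_cores.1 hC).2 S (Multigraph.mem_residual.1 hS).1⟩
  have hmin : Minimal (G.IsCover (G.residual F K)) I' := by
    rw [minimal_isCover_iff, Multigraph.isCover_iff] at hI ⊢
    refine ⟨fun S hS => ?_, fun e he hc => ?_⟩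
    · rw [Multigraph.mem_residual] at hS
      obtain ⟨e, he, hc⟩ := hI.1 S hS.1
      refine ⟨e, Finset.mem_filter.2 ⟨he, ?_⟩, hc⟩
      by_contra h
      exact hS.2 e (Finset.mem_filter.2 ⟨he, h⟩) hc
    · rw [hI', Finset.mem_filter] at he
      refine hI.2 e he.1 ?_
      rw [Multigraph.isCover_iff] at hc ⊢
      intro S hS
      by_cases hSK : S ∈ G.residual F K
      · obtain ⟨g, hg, hgS⟩ := hc S hSK
        exact ⟨g, Finset.erase_subset_erase e (Finset.filter_subset _ _) hg, hgS⟩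
      · rw [Multigraph.mem_residual] at hSK
        push Not at hSK
        obtain ⟨g, hg, hgS⟩ := hSK hS
        rw [hK, Finset.mem_filter] at hg
        exact ⟨g, Finset.mem_erase.2 ⟨fun h => hg.2 (h ▸ he.2), hg.1⟩, hgS⟩
  have hdeg : ∀ C ∈ cores F, G.deg I C = G.deg I' C := fun C hC => by
    unfold Multigraph.deg
    congr 1
    ext e
    simp only [hI', Finset.mem_filter]
    exact ⟨fun h => ⟨⟨h.1, C, hC, h.2⟩, h.2⟩, fun h => ⟨h.1.1, h.2⟩⟩
  rw [Finset.sum_congr rfl hdeg, ← hcores]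
  refine sum_deg_cores_le_of_covers_core (hF.residual K) hmin fun e he => ?_
  rw [hcores]
  exact (Finset.mem_filter.1 he).2

end DegreeBound

/-! ### The primal-dual analysis -/

section PrimalDual

variable {V E : Type*} [DecidableEq V] {G : Multigraph V E}
  {F K : Finset (Finset V)} {I J : Finset E} {L : List E} {c : E → ℝ} {y : Finset V → ℝ}

theorem load_raise (hK : K ⊆ F) (ε : ℝ) (e : E) :
    load G F (raise K ε y) e = load G F y e + ε * ((K.filter fun C => G.Covers e C).card : ℝ) := by
  have h : ∀ S, raise K ε y S = y S + if S ∈ K then ε else 0 := fun S => by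
    unfold raise
    split_ifs <;> simp
  have h' : ((F.filter fun C => G.Covers e C).filter (· ∈ K)) = K.filter fun C => G.Covers e C := by
    ext C
    simp only [Finset.mem_filter]
    exact ⟨fun h => ⟨h.2, h.1.2⟩, fun h => ⟨⟨hK h.1, h.2⟩, h.1⟩⟩
  simp only [load, h]
  rw [Finset.sum_add_distrib, ← Finset.sum_filter, h', Finset.sum_const, nsmul_eq_mul, mul_comm]

theorem sum_load (G : Multigraph V E) (F : Finset (Finset V)) (y : Finset V → ℝ) (J : Finset E) :
    ∑ e ∈ J, load G F y e = ∑ S ∈ F, (G.deg J S : ℝ) * y S := by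
  simp only [load, Multigraph.deg, Finset.sum_filter]
  rw [Finset.sum_comm]
  refine Finset.sum_congr rfl fun S _ => ?_
  rw [← Finset.sum_filter, Finset.sum_const, nsmul_eq_mul]

theorem cores_residual_subset : cores (G.residual F J) ⊆ F := fun _ hC =>
  (Multigraph.mem_residual.1 (mem_cores.1 hC).1).1

theorem filter_cores_residual_covers {e : E} (he : e ∈ J) :
    (cores (G.residual F J)).filter (fun C => G.Covers e C) = ∅ :=
  Finset.filter_eq_empty_iff.2 fun _ hC => (Multigraph.mem_residual.1 (mem_cores.1 hC).1).2 e he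

variable [DecidableEq E]

theorem Phase1.nodup (h : Phase1 G c F L y) : L.Nodup := by
  induction h with
  | start => exact List.nodup_nil
  | step L y ε e _ _ _ _ he _ ih => exact List.nodup_cons.2 ⟨he, ih⟩

theorem Phase1.nonneg (h : Phase1 G c F L y) (S : Finset V) : 0 ≤ y S := by
  induction h with
  | start => exact le_rfl
  | step L y ε e _ _ hε _ _ _ ih =>
    unfold raise
    split_ifs
    · exact add_nonneg ih hε
    · exact ih

theorem load_raise_of_mem {e : E} (he : e ∈ L) (ε : ℝ) :
    load G F (raise (cores (G.residual F L.toFinset)) ε y) e = load G F y e := by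
  rw [load_raise cores_residual_subset, filter_cores_residual_covers (List.mem_toFinset.2 he)]
  simp

theorem Phase1.load_eq (h : Phase1 G c F L y) {f : E} (hf : f ∈ L) : load G F y f = c f := by
  induction h with
  | start => simp at hf
  | step L y ε e _ _ _ _ _ ht ih =>
    by_cases hfL : f ∈ L
    · rw [load_raise_of_mem hfL, ih hfL]
    · obtain rfl : f = e := (List.mem_cons.1 hf).resolve_right hfL
      exact ht

theorem Phase1.load_le (hc : ∀ e, 0 ≤ c e) (h : Phase1 G c F L y) (f : E) :
    load G F y f ≤ c f := by
  induction h with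
  | start => simpa [load] using hc f
  | step L y ε e h _ _ hle _ _ ih =>
    by_cases hfL : f ∈ L
    · rw [load_raise_of_mem hfL]
      exact ih
    · exact hle f hfL

theorem sum_le_cost (hc : ∀ e, 0 ≤ c e) (h : Phase1 G c F L y) (hJ : G.IsCover F J) :
    ∑ S ∈ F, y S ≤ cost c J :=
  calc ∑ S ∈ F, y S ≤ ∑ S ∈ F, (G.deg J S : ℝ) * y S := Finset.sum_le_sum fun S hS =>
        le_mul_of_one_le_left (h.nonneg S) (by exact_mod_cast hJ S hS)
    _ = ∑ e ∈ J, load G F y e := (sum_load G F y J).symm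
    _ ≤ cost c J := Finset.sum_le_sum fun e _ => h.load_le hc e

theorem reverseDelete_subset (L : List E) (J : Finset E) : reverseDelete G F L J ⊆ J := by
  induction L generalizing J with
  | nil => exact subset_rfl
  | cons a L ih =>
    refine (ih _).trans ?_
    split_ifs
    · exact Finset.erase_subset a J
    · exact subset_rfl

theorem isCover_reverseDelete (L : List E) (hJ : G.IsCover F J) :
    G.IsCover F (reverseDelete G F L J) := by
  induction L generalizing J with
  | nil => exact hJ
  | cons a L ih =>
    refine ih ?_
    split_ifs with h
    · exact h
    · exact hJ

/-- An edge that reverse delete keeps is needed in the presence of all edges that were added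
before it. -/
theorem not_isCover_reverseDelete (hL : L.Nodup) (hLJ : L.toFinset ⊆ J) {L' : List E}
    (hL' : L' <:+ L) {e : E} (heL : e ∈ L) (heL' : e ∉ L') (he : e ∈ reverseDelete G F L J) :
    ¬ G.IsCover F ((reverseDelete G F L J ∪ L'.toFinset).erase e) := by
  induction L generalizing J with
  | nil => simp at heL
  | cons a L ih =>
    rcases List.suffix_cons_iff.1 hL' with rfl | hL''
    · exact (heL' heL).elim
    rw [List.nodup_cons] at hL
    have hLJ' : L.toFinset ⊆ if G.IsCover F (J.erase a) then J.erase a else J := by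
      intro x hx
      have hxJ : x ∈ J := hLJ (by simp_all)
      have hxa : x ≠ a := fun h => hL.1 (by simpa [h] using hx)
      split_ifs
      · exact Finset.mem_erase.2 ⟨hxa, hxJ⟩
      · exact hxJ
    by_cases hea : e = a
    · subst hea
      intro hcov
      simp only [reverseDelete] at he hcov
      by_cases h : G.IsCover F (J.erase e)
      · rw [if_pos h] at he
        exact Finset.notMem_erase e J (reverseDelete_subset _ _ he)
      · rw [if_neg h] at hcov hLJ'
        refine h (hcov.mono (Finset.erase_subset_erase e (Finset.union_subset
          (reverseDelete_subset _ _) fun x hx => hLJ' ?_)))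
        rw [List.mem_toFinset] at hx ⊢
        exact hL''.subset hx
    · exact ih hL.2 hLJ' hL'' ((List.mem_cons.1 heL).resolve_left hea) he

variable [Fintype V]

/-- The dual objective pays for the edges of `J`, by the degree bound in every iteration. -/
theorem Phase1.sum_deg_mul_le (hF : GammaPliable G F) (h : Phase1 G c F L y) (hJ : G.IsCover F J)
    (hmin : ∀ L' : List E, L' <:+ L → ∀ e ∈ J, e ∉ L' →
      ¬ G.IsCover F ((J ∪ L'.toFinset).erase e)) :
    ∑ S ∈ F, (G.deg J S : ℝ) * y S ≤ 7 * ∑ S ∈ F, y S := by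
  induction h with
  | start => simp
  | step L y ε e _ _ hε _ _ _ ih =>
    have ih' := ih fun L' hL' => hmin L' (hL'.trans (List.suffix_cons e L))
    set K := cores (G.residual F L.toFinset) with hK
    have hKF : K ⊆ F := cores_residual_subset
    have hmin' : Minimal (G.IsCover (G.residual F L.toFinset)) (J \ L.toFinset) := by
      rw [minimal_isCover_iff, Multigraph.isCover_iff]
      rw [Multigraph.isCover_iff] at hJ
      refine ⟨fun S hS => ?_, fun f hf hcov => ?_⟩
      · rw [Multigraph.mem_residual] at hS
        obtain ⟨f, hf, hfS⟩ := hJ S hS.1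
        exact ⟨f, Finset.mem_sdiff.2 ⟨hf, fun h => hS.2 f h hfS⟩, hfS⟩
      · rw [Finset.mem_sdiff] at hf
        refine hmin L (List.suffix_cons e L) f hf.1 (fun h => hf.2 (List.mem_toFinset.2 h)) ?_
        rw [Multigraph.isCover_iff] at hcov ⊢
        intro S hS
        by_cases hSL : S ∈ G.residual F L.toFinset
        · obtain ⟨g, hg, hgS⟩ := hcov S hSL
          exact ⟨g, Finset.erase_subset_erase f
            (Finset.sdiff_subset.trans Finset.subset_union_left) hg, hgS⟩
        · rw [Multigraph.mem_residual] at hSL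
          push Not at hSL
          obtain ⟨g, hg, hgS⟩ := hSL hS
          exact ⟨g, Finset.mem_erase.2 ⟨fun h => hf.2 (h ▸ hg), Finset.mem_union_right _ hg⟩, hgS⟩
    have hdeg : ∑ C ∈ K, G.deg J C ≤ 7 * K.card := by
      refine le_trans (Finset.sum_le_sum fun C hC => ?_) (sum_deg_cores_le (hF.residual _) hmin')
      refine Finset.card_le_card fun f hf => ?_
      rw [Finset.mem_filter] at hf ⊢
      exact ⟨Finset.mem_sdiff.2 ⟨hf.1, fun h =>
        (Multigraph.mem_residual.1 (mem_cores.1 hC).1).2 f h hf.2⟩, hf.2⟩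
    have hdeg' : ∑ C ∈ K, (G.deg J C : ℝ) ≤ 7 * (K.card : ℝ) := by exact_mod_cast hdeg
    have hr : ∀ S, raise K ε y S = y S + if S ∈ K then ε else 0 := fun S => by
      unfold raise
      split_ifs <;> simp
    have hFK : F.filter (· ∈ K) = K := by
      ext C
      simpa using fun h => hKF h
    have h1 : ∑ S ∈ F, (G.deg J S : ℝ) * raise K ε y S =
        ∑ S ∈ F, (G.deg J S : ℝ) * y S + ε * ∑ C ∈ K, (G.deg J C : ℝ) := by
      simp only [hr, mul_add, Finset.sum_add_distrib, mul_ite, mul_zero]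
      rw [← Finset.sum_filter, hFK, Finset.mul_sum]
      simp only [mul_comm]
    have h2 : ∑ S ∈ F, raise K ε y S = ∑ S ∈ F, y S + ε * K.card := by
      simp only [hr, Finset.sum_add_distrib]
      rw [← Finset.sum_filter, hFK, Finset.sum_const, nsmul_eq_mul, mul_comm]
    rw [h1, h2]
    nlinarith [mul_le_mul_of_nonneg_left hdeg' hε]

theorem IsWGMVOutput.isApproxSolution (hc : ∀ e, 0 ≤ c e) (hF : GammaPliable G F)
    (h : IsWGMVOutput G c F J) : IsApproxSolution G c F 7 J := by
  obtain ⟨L, y, hP, hL, rfl⟩ := h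
  rw [cores_residual_eq_empty_iff] at hL
  have hcov := isCover_reverseDelete (G := G) (F := F) L hL
  have hsub := reverseDelete_subset (G := G) (F := F) L L.toFinset
  refine ⟨hcov, fun J' hJ' => ?_⟩
  have h1 : cost c (reverseDelete G F L L.toFinset) =
      ∑ e ∈ reverseDelete G F L L.toFinset, load G F y e :=
    Finset.sum_congr rfl fun e he => (hP.load_eq (List.mem_toFinset.1 (hsub he))).symm
  rw [h1, sum_load]
  refine (hP.sum_deg_mul_le hF hcov fun L' hL' e he heL' => not_isCover_reverseDelete hP.nodup
    subset_rfl hL' (List.mem_toFinset.1 (hsub he)) heL' he).trans ?_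
  exact mul_le_mul_of_nonneg_left (sum_le_cost hc hP hJ') (by norm_num)

end PrimalDual

/-! ### Running times of programs -/

section Runs

variable {n m : ℕ} {O : Oracle n m} {p q : Cmd} {b : BExp} {σ : Store} {S T U : ℕ}
  {Q Q' : Store → Prop}

/-- The program `p`, started in `σ`, halts after at most `T` steps in a memory that satisfies
`Q`. -/
def Runs (O : Oracle n m) (p : Cmd) (σ : Store) (T : ℕ) (Q : Store → Prop) : Prop :=
  ∃ τ t, Exec O p σ τ t ∧ t ≤ T ∧ Q τ

theorem Runs.mono (h : Runs O p σ S Q) (hT : S ≤ T) (hQ : ∀ τ, Q τ → Q' τ) :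
    Runs O p σ T Q' := by
  obtain ⟨τ, t, h1, h2, h3⟩ := h
  exact ⟨τ, t, h1, h2.trans hT, hQ τ h3⟩

theorem Runs.skip (hT : 1 ≤ T) (h : Q σ) : Runs O .skip σ T Q :=
  ⟨σ, 1, .skip σ, hT, h⟩

theorem Runs.setNat {a : ℕ} {i x : NExp} (hT : i.steps + x.steps + 1 ≤ T)
    (h : Q (σ.writeNat a (i.eval O σ) (x.eval O σ))) : Runs O (.setNat a i x) σ T Q :=
  ⟨_, _, .setNat a i x σ, hT, h⟩

theorem Runs.setReal {a : ℕ} {i : NExp} {x : RExp} (hT : i.steps + x.steps + 1 ≤ T)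
    (h : Q (σ.writeReal a (i.eval O σ) (x.eval O σ))) : Runs O (.setReal a i x) σ T Q :=
  ⟨_, _, .setReal a i x σ, hT, h⟩

theorem Runs.seq (hp : Runs O p σ S Q') (hq : ∀ τ, Q' τ → Runs O q τ T Q) (hT : S + T ≤ U) :
    Runs O (.seq p q) σ U Q := by
  obtain ⟨τ, s, h1, h2, h3⟩ := hp
  obtain ⟨υ, t, h4, h5, h6⟩ := hq τ h3
  exact ⟨υ, s + t, .seq h1 h4, by omega, h6⟩

theorem Runs.ite (hp : b.Holds O σ → Runs O p σ T Q) (hq : ¬ b.Holds O σ → Runs O q σ T Q)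
    (hT : b.steps + T + 1 ≤ U) : Runs O (.ite b p q) σ U Q := by
  by_cases h : b.Holds O σ
  · obtain ⟨τ, t, h1, h2, h3⟩ := hp h
    exact ⟨τ, _, .iteTrue h h1, by omega, h3⟩
  · obtain ⟨τ, t, h1, h2, h3⟩ := hq h
    exact ⟨τ, _, .iteFalse h h1, by omega, h3⟩

/-- A while loop with an invariant `Inv k` that bounds the number of the remaining iterations
by `k`. -/
theorem Runs.loop {Inv : ℕ → Store → Prop}
    (hstep : ∀ k τ, Inv k τ → b.Holds O τ → ∃ k', k = k' + 1 ∧ Runs O p τ T (Inv k'))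
    (N : ℕ) (h : Inv N σ) :
    Runs O (.loop b p) σ (N * (b.steps + T + 1) + b.steps + 1)
      fun τ => (∃ k, Inv k τ) ∧ ¬ b.Holds O τ := by
  induction N using Nat.strong_induction_on generalizing σ with
  | _ N ih =>
    by_cases hb : b.Holds O σ
    · obtain ⟨k, rfl, τ, s, h1, h2, h3⟩ := hstep N σ h hb
      obtain ⟨υ, t, h4, h5, h6⟩ := ih k (Nat.lt_succ_self k) h3
      refine ⟨υ, _, .loopStep hb h1 h4, ?_, h6⟩
      rw [Nat.succ_mul]
      omega
    · exact ⟨σ, _, .loopDone hb, by omega, ⟨N, h⟩, hb⟩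

/-- A loop whose invariant `Inv i` determines that exactly `i` of `N` iterations are done. -/
theorem Runs.forLoop {Inv : ℕ → Store → Prop} (N : ℕ)
    (hb : ∀ i τ, Inv i τ → (b.Holds O τ ↔ i < N))
    (hstep : ∀ i < N, ∀ τ, Inv i τ → Runs O p τ T (Inv (i + 1))) (h : Inv 0 σ)
    (hU : N * (b.steps + T + 1) + b.steps + 1 ≤ U) :
    Runs O (.loop b p) σ U (Inv N) := by
  refine (Runs.loop (O := O) (p := p) (T := T) (Inv := fun k τ => ∃ i, i + k = N ∧ Inv i τ)
    ?_ N ⟨0, by simp, h⟩).mono hU ?_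
  · rintro k τ ⟨i, hik, hi⟩ hτ
    have hi' := (hb i τ hi).1 hτ
    exact ⟨k - 1, by omega, (hstep i hi' τ hi).mono le_rfl fun υ hυ => ⟨i + 1, by omega, hυ⟩⟩
  · rintro τ ⟨⟨k, i, hik, hi⟩, hτ⟩
    rw [hb i τ hi] at hτ
    obtain rfl : i = N := by omega
    exact hi

end Runs

section Memory

variable {σ : Store} {a b i x : ℕ} {z : ℝ}

theorem writeNat_nat : (σ.writeNat a i x).nat b =
    if b = a then Function.update (σ.nat a) i x else σ.nat b := by
  unfold Store.writeNat
  split_ifs with h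
  · subst h; simp
  · simp [h]

theorem writeNat_real : (σ.writeNat a i x).real = σ.real := rfl

theorem writeReal_nat : (σ.writeReal a i z).nat = σ.nat := rfl

theorem writeReal_real : (σ.writeReal a i z).real b =
    if b = a then Function.update (σ.real a) i z else σ.real b := by
  unfold Store.writeReal
  split_ifs with h
  · subst h; simp
  · simp [h]

theorem mem_decodeEdges {m : ℕ} {f : ℕ → ℕ} {e : Fin m} : e ∈ decodeEdges m f ↔ f e ≠ 0 := by
  simp [decodeEdges]

theorem decodeEdges_update_zero {m : ℕ} (f : ℕ → ℕ) (e : Fin m) :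
    decodeEdges m (Function.update f e 0) = (decodeEdges m f).erase e := by
  ext g
  rw [mem_decodeEdges, Finset.mem_erase, mem_decodeEdges, Function.update_apply]
  by_cases h : g = e
  · simp [h]
  · simp [h, Fin.val_inj]

theorem decodeEdges_update_one {m : ℕ} (f : ℕ → ℕ) (e : Fin m) :
    decodeEdges m (Function.update f e 1) = insert e (decodeEdges m f) := by
  ext g
  rw [mem_decodeEdges, Finset.mem_insert, mem_decodeEdges, Function.update_apply]
  by_cases h : g = e
  · simp [h]
  · simp [h, Fin.val_inj]

end Memory

section CoreOracle

variable {n m : ℕ} {G : Multigraph (Fin n) (Fin m)} {F : Finset (Finset (Fin n))} {O : Oracle n m}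

theorem Pliable.card_cores_le {V : Type*} [DecidableEq V] [Fintype V] {F : Finset (Finset V)}
    (hF : Pliable F) : (cores F).card ≤ Fintype.card V := by
  have hd : ((cores F : Finset (Finset V)) : Set (Finset V)).PairwiseDisjoint id :=
    fun C hC D hD hne => hF.disjoint_cores hC hD hne
  calc (cores F).card = ∑ C ∈ cores F, 1 := by simp
    _ ≤ ∑ C ∈ cores F, C.card := Finset.sum_le_sum fun C hC =>
        Finset.card_pos.2 (hF.nonempty (mem_cores.1 hC).1)
    _ = ((cores F).biUnion id).card := (Finset.card_biUnion hd).symm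
    _ ≤ Fintype.card V := Finset.card_le_univ _

theorem IsCoreOracle.toFinset_eq (hO : IsCoreOracle G F O) (J : Finset (Fin m)) :
    (O J).toFinset = cores (G.residual F J) := by
  ext C
  rw [List.mem_toFinset, (hO J).2]

theorem IsCoreOracle.length_le (hO : IsCoreOracle G F O) (hF : Pliable F) (J : Finset (Fin m)) :
    (O J).length ≤ n := by
  rw [← List.toFinset_card_of_nodup (hO J).1, hO.toFinset_eq]
  simpa using (hF.residual J).card_cores_le

theorem IsCoreOracle.one_le_length_iff (hO : IsCoreOracle G F O) (J : Finset (Fin m)) :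
    1 ≤ (O J).length ↔ ¬ G.IsCover F J := by
  rw [← cores_residual_eq_empty_iff, ← hO.toFinset_eq, List.toFinset_eq_empty_iff,
    ← List.length_eq_zero_iff]
  omega

/-- The number of sets in the list `l` that the edge `e` covers. -/
def coveredCount (G : Multigraph (Fin n) (Fin m)) (l : List (Finset (Fin n))) (e : Fin m) : ℕ :=
  l.countP fun C => decide (G.Covers e C)

theorem IsCoreOracle.coveredCount_eq (hO : IsCoreOracle G F O) (J : Finset (Fin m)) (e : Fin m) :
    coveredCount G (O J) e = ((cores (G.residual F J)).filter fun C => G.Covers e C).card := by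
  rw [← hO.toFinset_eq, coveredCount, List.countP_eq_length_filter,
    ← List.toFinset_card_of_nodup ((hO J).1.filter _)]
  congr 1
  ext C
  simp

theorem memberBit_of_lt {l : List (Finset (Fin n))} {i : ℕ} (hi : i < l.length) (v : Fin n) :
    memberBit l i v = if v ∈ l[i] then 1 else 0 := by
  simp [memberBit, hi]

/-- The distance between the two membership bits of the ends of an edge, written with truncated
subtraction, indicates whether the edge covers the set. -/
theorem coveredCount_take_succ (l : List (Finset (Fin n))) {i : ℕ} (hi : i < l.length)
    (e : Fin m) : coveredCount G (l.take (i + 1)) e = coveredCount G (l.take i) e +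
      (memberBit l i (G.ends e).1 - memberBit l i (G.ends e).2 +
        (memberBit l i (G.ends e).2 - memberBit l i (G.ends e).1)) := by
  rw [memberBit_of_lt hi, memberBit_of_lt hi, coveredCount, List.take_succ_eq_append_getElem hi,
    List.countP_append, List.countP_singleton]
  simp only [decide_eq_true_eq, Multigraph.covers_iff, coveredCount]
  by_cases h1 : (G.ends e).1 ∈ l[i] <;> by_cases h2 : (G.ends e).2 ∈ l[i] <;> simp [h1, h2]

end CoreOracle

/-! ### The program -/

namespace Program

/-- The edge counter of the loops over all edges. -/
def edge : NExp := .get 6 (.lit 0)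

/-- The counter of the loop over the residual cores. -/
def core : NExp := .get 7 (.lit 0)

/-- Add 1 to cell `edge` of array 8 if the edge covers the residual core with number `core`. -/
def degreeBody : Cmd :=
  .seq (.setNat 8 edge (.add (.get 8 edge)
      (.add (.sub (.inCore 3 core (.get 1 edge)) (.inCore 3 core (.get 2 edge)))
        (.sub (.inCore 3 core (.get 2 edge)) (.inCore 3 core (.get 1 edge))))))
    (.setNat 7 (.lit 0) (.add core (.lit 1)))

/-- Write the number of residual cores that the edge covers into array 8. -/
def degree : Cmd :=
  .seq (.setNat 8 edge (.lit 0)) (.seq (.setNat 7 (.lit 0) (.lit 0))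
    (.loop (.natLe (.add core (.lit 1)) (.coreCount 3)) degreeBody))

/-- The amount by which the dual variables can be raised until the edge is tight. -/
def ratio : RExp := .divNat (.get 0 edge) (.get 8 edge)

/-- Make the edge the best one so far. Cell 0 of array 9 holds its successor, 0 meaning that
there is none yet, and array 1 of real numbers its ratio. -/
def select : Cmd :=
  .seq (.setNat 9 (.lit 0) (.add edge (.lit 1))) (.setReal 1 (.lit 0) ratio)

/-- Select the edge if it covers a residual core and its ratio is smallest so far. -/
def compare : Cmd :=
  .ite (.natLe (.lit 1) (.get 8 edge))
    (.ite (.natLe (.get 9 (.lit 0)) (.lit 0)) select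
      (.ite (.realLe ratio (.get 1 (.lit 0))) select .skip)) .skip

/-- Run `p` for all edges. -/
def forEdges (p : Cmd) : Cmd :=
  .seq (.setNat 6 (.lit 0) (.lit 0)) (.loop (.natLe (.add edge (.lit 1)) (.get 0 (.lit 1)))
    (.seq p (.setNat 6 (.lit 0) (.add edge (.lit 1)))))

/-- Find an edge that gets tight first. -/
def scan : Cmd := .seq (.setNat 9 (.lit 0) (.lit 0)) (forEdges (.seq degree compare))

/-- Array 0 of real numbers holds what remains of the costs after the dual variables are paid. -/
def pay : Cmd :=
  .setReal 0 edge (.sub (.get 0 edge) (.mulNat (.get 1 (.lit 0)) (.get 8 edge)))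

/-- Add the selected edge to the edge set in array 3 and to the list in array 4, the length of
which is held in array 5. -/
def pick : Cmd :=
  .seq (.setNat 3 (.sub (.get 9 (.lit 0)) (.lit 1)) (.lit 1))
    (.seq (.setNat 4 (.get 5 (.lit 0)) (.sub (.get 9 (.lit 0)) (.lit 1)))
      (.setNat 5 (.lit 0) (.add (.get 5 (.lit 0)) (.lit 1))))

/-- One iteration of the first phase. -/
def iteration : Cmd := .seq scan (.seq (forEdges pay) pick)

/-- The first phase. -/
def phase1 : Cmd := .loop (.natLe (.lit 1) (.coreCount 3)) iteration

/-- Remove the last edge of the list, and delete it from the edge set unless a residual core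
appears. -/
def deletion : Cmd :=
  .seq (.setNat 5 (.lit 0) (.sub (.get 5 (.lit 0)) (.lit 1)))
    (.seq (.setNat 3 (.get 4 (.get 5 (.lit 0))) (.lit 0))
      (.ite (.natLe (.lit 1) (.coreCount 3))
        (.setNat 3 (.get 4 (.get 5 (.lit 0))) (.lit 1)) .skip))

/-- The reverse delete phase. -/
def phase2 : Cmd := .loop (.natLe (.lit 1) (.get 5 (.lit 0))) deletion

/-- The primal-dual algorithm with reverse delete. -/
def wgmv : Cmd := .seq phase1 phase2

variable {n m : ℕ} {G : Multigraph (Fin n) (Fin m)} {F : Finset (Finset (Fin n))} {O : Oracle n m}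
  {σ : Store}

/-- The memory holds the graph. -/
structure HoldsGraph (G : Multigraph (Fin n) (Fin m)) (σ : Store) : Prop where
  edges : σ.nat 0 1 = m
  fst : ∀ e : Fin m, σ.nat 1 e = (G.ends e).1
  snd : ∀ e : Fin m, σ.nat 2 e = (G.ends e).2

theorem HoldsGraph.congr {τ : Store} (h : HoldsGraph G σ) (hτ : ∀ a ≤ 2, τ.nat a = σ.nat a) :
    HoldsGraph G τ :=
  ⟨by rw [hτ 0 (by omega), h.edges], fun e => by rw [hτ 1 (by omega), h.fst],
    fun e => by rw [hτ 2 (by omega), h.snd]⟩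

/-- The residual cores of the edge set in array 3. -/
def coreList (O : Oracle n m) (σ : Store) : List (Finset (Fin n)) := O (decodeEdges m (σ.nat 3))

theorem runs_degree (hG : HoldsGraph G σ) (hk : (coreList O σ).length ≤ n) (e : Fin m)
    (he : σ.nat 6 0 = e) :
    Runs O degree σ (47 * n + 14) fun τ => τ.real = σ.real ∧
      (∀ a, a ≠ 7 → a ≠ 8 → τ.nat a = σ.nat a) ∧
      τ.nat 8 = Function.update (σ.nat 8) e (coveredCount G (coreList O σ) e) := by
  set l := coreList O σ with hl
  let Inv : ℕ → Store → Prop := fun i τ => i ≤ l.length ∧ τ.real = σ.real ∧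
    (∀ a, a ≠ 7 → a ≠ 8 → τ.nat a = σ.nat a) ∧ τ.nat 7 0 = i ∧
    τ.nat 8 = Function.update (σ.nat 8) e (coveredCount G (l.take i) e)
  refine Runs.seq (S := 4) (T := 47 * n + 10) (Runs.setNat (by rfl) rfl) ?_ (by omega)
  rintro _ rfl
  refine Runs.seq (S := 3) (T := 47 * n + 7) (Runs.setNat (by rfl) rfl) ?_ (by omega)
  rintro _ rfl
  refine (Runs.forLoop (Inv := Inv) (T := 40) (U := 47 * n + 7) l.length ?_ ?_ ?_ ?_).mono
    le_rfl ?_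
  · rintro i τ ⟨hi, hr, ha, h7, h8⟩
    simp only [BExp.Holds, NExp.eval, core, h7, ha 3 (by decide) (by decide)]
    change i + 1 ≤ l.length ↔ _
    omega
  · rintro i hi τ ⟨-, hr, ha, h7, h8⟩
    refine Runs.seq (S := 34) (T := 6) (Runs.setNat (by rfl) rfl) ?_ (by omega)
    rintro _ rfl
    refine Runs.setNat (by rfl) ?_
    have h6 : τ.nat 6 0 = e := by rw [ha 6 (by decide) (by decide), he]
    have hO : O (decodeEdges m (τ.nat 3)) = l := by rw [ha 3 (by decide) (by decide)]; rfl
    refine ⟨hi, hr, fun a ha7 ha8 => ?_, ?_, ?_⟩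
    · simp [writeNat_nat, ha7, ha8, ha]
    · simp [writeNat_nat, NExp.eval, core, h7]
    · simp [writeNat_nat, NExp.eval, core, edge, h7, h6, h8, hO, ha 1, ha 2, hG.fst, hG.snd,
        coveredCount_take_succ l hi e]
  · refine ⟨Nat.zero_le _, rfl, fun a ha7 ha8 => ?_, ?_, ?_⟩
    · simp [writeNat_nat, ha7, ha8]
    · simp [writeNat_nat, NExp.eval]
    · simp [writeNat_nat, NExp.eval, edge, he, coveredCount]
  · have : l.length * 47 ≤ n * 47 := Nat.mul_le_mul_right 47 hk
    simp only [BExp.steps, NExp.steps, core]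
    omega
  · rintro τ ⟨-, hr, ha, -, h8⟩
    rw [List.take_length] at h8
    exact ⟨hr, ha, h8⟩

/-- The loop over all edges, for an invariant `Inv i` that describes the memory when the first
`i` edges are processed. -/
theorem runs_forEdges {p : Cmd} {T U : ℕ} {Inv : ℕ → Store → Prop}
    (hm : ∀ i τ, Inv i τ → τ.nat 0 1 = m)
    (h0 : Inv 0 (σ.writeNat 6 0 0))
    (hp : ∀ (e : Fin m) (τ : Store), Inv e τ → τ.nat 6 0 = e → Runs O p τ T fun υ =>
      υ.nat 6 0 = e ∧ Inv (e + 1) (υ.writeNat 6 0 (e + 1)))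
    (hU : m * (T + 15) + 12 ≤ U) :
    Runs O (forEdges p) σ U (Inv m) := by
  refine Runs.seq (S := 3) (T := m * (T + 15) + 9) (Runs.setNat (by rfl) rfl) ?_ (by omega)
  rintro _ rfl
  refine (Runs.forLoop (Inv := fun i τ => τ.nat 6 0 = i ∧ Inv i τ) (T := T + 6) m ?_ ?_ ?_ ?_).mono
    le_rfl fun τ h => h.2
  · rintro i τ ⟨h6, hi⟩
    simp only [BExp.Holds, NExp.eval, edge, h6, hm i τ hi]
    omega
  · rintro i hi τ ⟨h6, hI⟩
    refine Runs.seq (hp ⟨i, hi⟩ τ hI h6) ?_ (le_refl _)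
    rintro υ ⟨h6', hI'⟩
    refine Runs.setNat (by rfl) ?_
    simp only [NExp.eval, edge, h6'] at hI' ⊢
    exact ⟨by simp [writeNat_nat], hI'⟩
  · exact ⟨by simp [writeNat_nat, NExp.eval], h0⟩
  · simp only [BExp.steps, NExp.steps, edge]
    nlinarith

/-- The memory after the scan of the first `i` edges, where `d e` is the number of residual cores
that the edge `e` covers, and `s e` is what remains of its cost. -/
structure Scanned (d : Fin m → ℕ) (s : Fin m → ℝ) (i : ℕ) (σ : Store) : Prop where
  deg : ∀ f : Fin m, (f : ℕ) < i → σ.nat 8 f = d f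
  rest : ∀ f : Fin m, σ.real 0 f = s f
  best : (σ.nat 9 0 = 0 ∧ ∀ f : Fin m, (f : ℕ) < i → d f = 0) ∨
    ∃ e : Fin m, σ.nat 9 0 = e + 1 ∧ 0 < d e ∧ σ.real 1 0 = s e / d e ∧
      ∀ f : Fin m, (f : ℕ) < i → 0 < d f → σ.real 1 0 ≤ s f / d f

theorem Scanned.writeNat_edge {d : Fin m → ℕ} {s : Fin m → ℝ} {i x : ℕ} (h : Scanned d s i σ) :
    Scanned d s i (σ.writeNat 6 0 x) := by
  refine ⟨fun f hf => ?_, h.rest, ?_⟩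
  · simpa [writeNat_nat] using h.deg f hf
  · simpa [writeNat_nat, writeNat_real] using h.best

theorem runs_compare {d : Fin m → ℕ} {s : Fin m → ℝ} {τ : Store} (e : Fin m)
    (h : Scanned d s e τ) (he : τ.nat 6 0 = e) (hr : σ.real = τ.real)
    (ha : ∀ a, a ≠ 7 → a ≠ 8 → σ.nat a = τ.nat a) (h8 : σ.nat 8 = Function.update (τ.nat 8) e (d e)) :
    Runs O compare σ 37 fun υ => (∀ a ≤ 6, υ.nat a = σ.nat a) ∧ Scanned d s (e + 1) υ := by
  have h6 : σ.nat 6 0 = e := by rw [ha 6 (by decide) (by decide), he]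
  have h9 : σ.nat 9 = τ.nat 9 := ha 9 (by decide) (by decide)
  have h8e : σ.nat 8 e = d e := by simp [h8]
  have hdeg : ∀ f : Fin m, (f : ℕ) < e + 1 → σ.nat 8 f = d f := by
    intro f hf
    rcases Nat.lt_succ_iff_lt_or_eq.1 hf with hf | hf
    · rw [h8, Function.update_of_ne hf.ne, h.deg f hf]
    · obtain rfl := Fin.ext hf
      exact h8e
  have hrest : ∀ f : Fin m, σ.real 0 f = s f := fun f => by rw [hr, h.rest]
  -- the selection is correct if the ratio of `e` is at most the best one so far
  have hsel : 0 < d e → (∀ f : Fin m, (f : ℕ) < e → 0 < d f → s e / d e ≤ s f / d f) →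
      Runs O select σ 15 fun υ => (∀ a ≤ 6, υ.nat a = σ.nat a) ∧ Scanned d s (e + 1) υ := by
    intro hpos hmin
    refine Runs.seq (S := 6) (T := 9) (Runs.setNat (by rfl) rfl) ?_ (by omega)
    rintro _ rfl
    refine Runs.setReal (by rfl) ⟨fun a ha6 => ?_, fun f hf => ?_, fun f => ?_, Or.inr ⟨e, ?_⟩⟩
    · simp [writeNat_nat, writeReal_nat, show a ≠ 9 by omega]
    · simpa [writeNat_nat, writeReal_nat] using hdeg f hf
    · simpa [writeReal_real, writeNat_real] using hrest f
    · have hreal : RExp.eval O (σ.writeNat 9 0 (e + 1)) ratio = s e / d e := by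
        simp [RExp.eval, ratio, NExp.eval, edge, writeNat_real, writeNat_nat, h6, hrest, h8e]
      simp only [NExp.eval, edge, h6] at hreal ⊢
      rw [hreal]
      refine ⟨by simp [writeNat_nat, writeReal_nat], hpos, by simp [writeReal_real], ?_⟩
      intro f hf hfpos
      simp only [writeReal_real, if_true, Function.update_self]
      rcases Nat.lt_succ_iff_lt_or_eq.1 hf with hf | hf
      · exact hmin f hf hfpos
      · rw [Fin.ext hf]
  have hskip : (0 < d e → ∃ g : Fin m, σ.nat 9 0 = g + 1 ∧ σ.real 1 0 ≤ s e / d e) →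
      Runs O .skip σ 15 fun υ => (∀ a ≤ 6, υ.nat a = σ.nat a) ∧ Scanned d s (e + 1) υ := by
    intro hmin
    refine Runs.skip (by omega) ⟨fun _ _ => rfl, hdeg, hrest, ?_⟩
    rw [h9, hr] at *
    rcases h.best with ⟨h0, hz⟩ | ⟨g, hg, hpos, hbest, hall⟩
    · refine Or.inl ⟨h0, fun f hf => ?_⟩
      rcases Nat.lt_succ_iff_lt_or_eq.1 hf with hf | hf
      · exact hz f hf
      · rw [Fin.ext hf]
        by_contra hne
        obtain ⟨g, hg, -⟩ := hmin (Nat.pos_of_ne_zero hne)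
        omega
    · refine Or.inr ⟨g, hg, hpos, hbest, fun f hf hfpos => ?_⟩
      rcases Nat.lt_succ_iff_lt_or_eq.1 hf with hf | hf
      · exact hall f hf hfpos
      · obtain rfl := Fin.ext hf
        exact (hmin hfpos).choose_spec.2
  have hratio : RExp.eval O σ ratio = s e / d e := by
    simp [RExp.eval, ratio, NExp.eval, edge, h6, hrest, h8e]
  refine Runs.ite (T := 31) (fun hb => ?_) (fun hb => (hskip fun hpos => ?_).mono (by omega)
    fun _ h => h) (le_refl _)
  · have hpos : 1 ≤ d e := by simpa [BExp.Holds, NExp.eval, edge, h6, h8e] using hb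
    refine Runs.ite (T := 26) (fun hb' => (hsel hpos ?_).mono (by omega) fun _ h => h)
      (fun hb' => ?_) (le_refl _)
    · have h0 : τ.nat 9 0 = 0 := by simpa [BExp.Holds, NExp.eval, h9] using hb'
      rcases h.best with ⟨-, hz⟩ | ⟨g, hg, -⟩
      · intro f hf hfpos
        rw [hz f hf] at hfpos
        exact (lt_irrefl _ hfpos).elim
      · omega
    · have h0 : τ.nat 9 0 ≠ 0 := by simpa [BExp.Holds, NExp.eval, h9] using hb'
      obtain ⟨g, hg, -, hbest, hall⟩ := h.best.resolve_left fun h' => h0 h'.1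
      refine Runs.ite (T := 15) (fun hle => hsel hpos fun f hf hfpos => ?_)
        (fun hle => hskip fun _ => ⟨g, by rw [h9, hg], ?_⟩) (le_refl _)
      · simp only [BExp.Holds, hratio, RExp.eval, NExp.eval, hr] at hle
        exact hle.trans (hall f hf hfpos)
      · simp only [BExp.Holds, hratio, RExp.eval, NExp.eval] at hle
        exact (not_le.1 hle).le
  · have : ¬ 0 < d e := by simpa [BExp.Holds, NExp.eval, edge, h6, h8e] using hb
    exact (this hpos).elim

theorem runs_scan (hG : HoldsGraph G σ) (hk : (coreList O σ).length ≤ n) :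
    Runs O scan σ (m * (47 * n + 66) + 15) fun τ => (∀ a ≤ 5, τ.nat a = σ.nat a) ∧
      Scanned (coveredCount G (coreList O σ)) (fun e => σ.real 0 e) m τ := by
  refine Runs.seq (S := 3) (T := m * (47 * n + 66) + 12) (Runs.setNat (by rfl) rfl) ?_ (by omega)
  rintro _ rfl
  refine runs_forEdges (T := 47 * n + 51) (Inv := fun i τ => (∀ a ≤ 5, τ.nat a = σ.nat a) ∧
    Scanned (coveredCount G (coreList O σ)) (fun e => σ.real 0 e) i τ) ?_ ?_ ?_ (le_refl _)
  · rintro i τ ⟨ha, -⟩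
    rw [ha 0 (by omega), hG.edges]
  · refine ⟨fun a ha => ?_, fun f hf => ?_, fun f => ?_, Or.inl ⟨?_, fun f hf => ?_⟩⟩
    · simp [writeNat_nat, show a ≠ 6 by omega, show a ≠ 9 by omega]
    · omega
    · simp [writeNat_real]
    · simp [writeNat_nat, NExp.eval]
    · omega
  · rintro e τ ⟨ha, hs⟩ h6
    have hl : coreList O τ = coreList O σ := by rw [coreList, coreList, ha 3 (by omega)]
    have hG' : HoldsGraph G τ := hG.congr fun a h => ha a (by omega)
    refine Runs.seq (runs_degree hG' (hl ▸ hk) e h6) ?_ (by omega : 47 * n + 14 + 37 ≤ _)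
    rintro υ ⟨hr, ha', h8⟩
    rw [hl] at h8
    refine (runs_compare e hs h6 hr ha' h8).mono le_rfl ?_
    rintro ρ ⟨hρ, hρs⟩
    refine ⟨by rw [hρ 6 le_rfl, ha' 6 (by decide) (by decide), h6], fun a h5 => ?_,
      hρs.writeNat_edge⟩
    rw [writeNat_nat, if_neg (by omega), hρ a (by omega), ha' a (by omega) (by omega), ha a h5]

theorem runs_pay (hm : σ.nat 0 1 = m) :
    Runs O (forEdges pay) σ (m * 28 + 12) fun τ => (∀ a, a ≠ 6 → τ.nat a = σ.nat a) ∧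
      ∀ f : Fin m, τ.real 0 f = σ.real 0 f - σ.real 1 0 * σ.nat 8 f := by
  refine (runs_forEdges (T := 13) (Inv := fun i τ => (∀ a, a ≠ 6 → τ.nat a = σ.nat a) ∧
    τ.real 1 = σ.real 1 ∧ ∀ f : Fin m, τ.real 0 f =
      if (f : ℕ) < i then σ.real 0 f - σ.real 1 0 * σ.nat 8 f else σ.real 0 f) ?_ ?_ ?_
    (le_refl _)).mono le_rfl ?_
  · rintro i τ ⟨ha, -⟩
    rw [ha 0 (by omega), hm]
  · exact ⟨fun a ha => by simp [writeNat_nat, ha], rfl, fun f => by simp [writeNat_real]⟩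
  · rintro e τ ⟨ha, h1, h0⟩ h6
    refine Runs.setReal (by rfl) ⟨h6, fun a h => ?_, ?_, fun f => ?_⟩
    · simp [writeNat_nat, writeReal_nat, h, ha]
    · simp [writeReal_real, writeNat_real, h1]
    · by_cases hf : f = e
      · subst hf
        simp [writeReal_real, writeNat_real, NExp.eval, RExp.eval, edge, h6, h1, h0, ha 8]
      · have hne : (f : ℕ) ≠ e := fun h => hf (Fin.ext h)
        have hlt : (f : ℕ) < e + 1 ↔ (f : ℕ) < e := by omega
        simp [writeReal_real, writeNat_real, NExp.eval, edge, h6, h0, hne, hlt]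
  · rintro τ ⟨ha, -, h0⟩
    exact ⟨ha, fun f => by rw [h0, if_pos f.isLt]⟩

/-! ### Correctness and running time of the program -/

variable {L : List (Fin m)} {c : Fin m → ℝ} {y : Finset (Fin n) → ℝ}

/-- The cells of `g` hold the members of the list `L`, the head being in the last cell. -/
def Listed : List (Fin m) → (ℕ → ℕ) → Prop
  | [], _ => True
  | e :: L, g => g L.length = e ∧ Listed L g

theorem Listed.update {g : ℕ → ℕ} (h : Listed L g) {i x : ℕ} (hi : L.length ≤ i) :
    Listed L (Function.update g i x) := by
  induction L with
  | nil => trivial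
  | cons e L ih =>
    rw [List.length_cons] at hi
    exact ⟨by rw [Function.update_of_ne (by omega), h.1], ih h.2 (by omega)⟩

/-- The memory between two iterations of the first phase. -/
structure Represents (G : Multigraph (Fin n) (Fin m)) (c : Fin m → ℝ)
    (F : Finset (Finset (Fin n))) (L : List (Fin m)) (y : Finset (Fin n) → ℝ) (σ : Store) :
    Prop where
  graph : HoldsGraph G σ
  edges : decodeEdges m (σ.nat 3) = L.toFinset
  listed : Listed L (σ.nat 4)
  length : σ.nat 5 0 = L.length
  rest : ∀ e : Fin m, σ.real 0 e = c e - load G F y e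
  phase : Phase1 G c F L y

/-- An edge that minimizes the ratio of its remaining cost to the number of residual cores it
covers is a legal choice in the first phase. -/
theorem phase1_step (hc : ∀ e, 0 ≤ c e) (h : Phase1 G c F L y) {d : Fin m → ℕ}
    (hd : ∀ e, d e = ((cores (G.residual F L.toFinset)).filter fun C => G.Covers e C).card)
    {e : Fin m} {ε : ℝ} (hpos : 0 < d e) (hε : ε = (c e - load G F y e) / d e)
    (hmin : ∀ f, 0 < d f → ε ≤ (c f - load G F y f) / d f) :
    Phase1 G c F (e :: L) (raise (cores (G.residual F L.toFinset)) ε y) := by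
  have hpos' : (0 : ℝ) < d e := by exact_mod_cast hpos
  have hload : ∀ f, load G F (raise (cores (G.residual F L.toFinset)) ε y) f =
      load G F y f + ε * d f := fun f => by rw [load_raise cores_residual_subset, hd]
  refine .step L y ε e h ?_ ?_ (fun f _ => ?_) (fun he => ?_) ?_
  · rw [hd, Finset.card_pos] at hpos
    exact hpos.mono (Finset.filter_subset _ _)
  · rw [hε]
    exact div_nonneg (sub_nonneg.2 (h.load_le hc e)) hpos'.le
  · rw [hload]
    rcases Nat.eq_zero_or_pos (d f) with hf | hf
    · rw [hf, Nat.cast_zero, mul_zero, add_zero]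
      exact h.load_le hc f
    · have h1 := hmin f hf
      rw [le_div_iff₀ (by exact_mod_cast hf)] at h1
      linarith
  · rw [hd, filter_cores_residual_covers (List.mem_toFinset.2 he), Finset.card_empty] at hpos
    exact lt_irrefl _ hpos
  · rw [hload, hε, div_mul_cancel₀ _ hpos'.ne']
    ring

theorem runs_iteration (hc : ∀ e, 0 ≤ c e) (hF : Pliable F) (hcov : G.IsCover F Finset.univ)
    (hO : IsCoreOracle G F O) (h : Represents G c F L y σ) (hL : ¬ G.IsCover F L.toFinset) :
    Runs O iteration σ (m * (47 * n + 94) + 46) fun τ =>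
      ∃ e y', Represents G c F (e :: L) y' τ := by
  have hl : coreList O σ = O L.toFinset := by rw [coreList, h.edges]
  have hd := hO.coveredCount_eq L.toFinset
  -- the graph covers the residual cores, so that some edge can be selected
  obtain ⟨f₀, hf₀⟩ : ∃ f, 0 < coveredCount G (O L.toFinset) f := by
    rw [← cores_residual_eq_empty_iff] at hL
    obtain ⟨C, hC⟩ := Finset.nonempty_of_ne_empty hL
    obtain ⟨f, -, hf⟩ := Multigraph.isCover_iff.1 hcov C (cores_residual_subset hC)
    exact ⟨f, by rw [hd]; exact Finset.card_pos.2 ⟨C, Finset.mem_filter.2 ⟨hC, hf⟩⟩⟩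
  have hk : (coreList O σ).length ≤ n := by
    rw [hl]
    exact hO.length_le hF _
  have hscan := runs_scan h.graph hk
  rw [hl] at hscan
  refine Runs.seq hscan ?_ (T := m * 28 + 31) (by nlinarith)
  rintro τ ⟨hτa, hτ⟩
  obtain ⟨e, h9, hpos, hε, hmin⟩ : ∃ e : Fin m, τ.nat 9 0 = e + 1 ∧
      0 < coveredCount G (O L.toFinset) e ∧
      τ.real 1 0 = σ.real 0 e / coveredCount G (O L.toFinset) e ∧
      ∀ f : Fin m, (f : ℕ) < m → 0 < coveredCount G (O L.toFinset) f →
        τ.real 1 0 ≤ σ.real 0 f / coveredCount G (O L.toFinset) f :=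
    hτ.best.resolve_left fun hz => hf₀.ne' (hz.2 f₀ f₀.isLt)
  have hrest : ∀ f : Fin m, σ.real 0 f = c f - load G F y f := h.rest
  rw [hrest] at hε
  have hphase := phase1_step hc h.phase hd hpos hε fun f hf => by
    rw [← hrest]
    exact hmin f f.isLt hf
  have hτ0 : τ.nat 0 1 = m := by rw [hτa 0 (by omega), h.graph.edges]
  refine Runs.seq (runs_pay hτ0) ?_ (T := 19) (by omega)
  rintro υ ⟨hυa, hυ⟩
  have hυ9 : υ.nat 9 0 = e + 1 := by rw [hυa 9 (by decide), h9]
  have hυ5 : υ.nat 5 0 = L.length := by rw [hυa 5 (by decide), hτa 5 (by omega), h.length]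
  refine Runs.seq (S := 6) (T := 13) (Runs.setNat (by rfl) rfl) ?_ (by omega)
  rintro _ rfl
  refine Runs.seq (S := 7) (T := 6) (Runs.setNat (by rfl) rfl) ?_ (by omega)
  rintro _ rfl
  refine Runs.setNat (by rfl) ⟨e, _, ?_, ?_, ?_, ?_, fun f => ?_, hphase⟩
  · refine h.graph.congr fun a ha => ?_
    simp only [writeNat_nat, show a ≠ 3 by omega, show a ≠ 4 by omega, show a ≠ 5 by omega,
      if_false]
    rw [hυa a (by omega), hτa a (by omega)]
  · have h3 : υ.nat 3 = σ.nat 3 := by rw [hυa 3 (by decide), hτa 3 (by omega)]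
    simp [writeNat_nat, NExp.eval, hυ9, h3, decodeEdges_update_one, h.edges]
  · have h4 : υ.nat 4 = σ.nat 4 := by rw [hυa 4 (by decide), hτa 4 (by omega)]
    simp only [writeNat_nat, NExp.eval, hυ9, h4]
    simp only [show (4 : ℕ) ≠ 5 by decide, show (5 : ℕ) ≠ 3 by decide, show (9 : ℕ) ≠ 3 by decide,
      show (4 : ℕ) ≠ 3 by decide, if_false, if_true, hυ5, hυ9]
    exact ⟨by simp, h.listed.update le_rfl⟩
  · simp [writeNat_nat, NExp.eval, hυ5]
  · rw [writeNat_real, writeNat_real, writeNat_real, hυ, hτ.rest, hrest,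
      load_raise cores_residual_subset, hτ.deg f f.isLt, hd]
    ring

theorem runs_phase1 (hc : ∀ e, 0 ≤ c e) (hF : Pliable F) (hcov : G.IsCover F Finset.univ)
    (hO : IsCoreOracle G F O) (h : Represents G c F [] y σ) :
    Runs O phase1 σ (m * (m * (47 * n + 94) + 50) + 4) fun τ =>
      ∃ L y', Represents G c F L y' τ ∧ G.IsCover F L.toFinset := by
  have hb : ∀ {τ : Store} {L y'}, Represents G c F L y' τ →
      (BExp.Holds O τ (.natLe (.lit 1) (.coreCount 3)) ↔ ¬ G.IsCover F L.toFinset) := by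
    intro τ L y' h
    rw [← hO.one_le_length_iff]
    simp only [BExp.Holds, NExp.eval, h.edges]
  refine (Runs.loop (T := m * (47 * n + 94) + 46)
    (Inv := fun k τ => ∃ L y', L.length + k = m ∧ Represents G c F L y' τ) ?_ m
    ⟨[], y, by simp, h⟩).mono ?_ ?_
  · rintro k τ ⟨L, y', hk, hL⟩ hτ
    rw [hb hL] at hτ
    -- the list of a further iteration has no repetitions either, hence at most `m` members
    have hrun := runs_iteration hc hF hcov hO hL hτ
    have hlt : L.length < m := by
      obtain ⟨_, _, _, _, e, y'', hL'⟩ := hrun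
      have := hL'.phase.nodup.length_le_card
      simpa using this
    refine ⟨k - 1, by omega, hrun.mono le_rfl ?_⟩
    rintro υ ⟨e, y'', hL'⟩
    exact ⟨e :: L, y'', by simp only [List.length_cons]; omega, hL'⟩
  · simp only [BExp.steps, NExp.steps]
    nlinarith
  · rintro τ ⟨⟨k, L, y', -, hL⟩, hτ⟩
    rw [hb hL, not_not] at hτ
    exact ⟨L, y', hL, hτ⟩

/-- The memory between two deletions: the edges in `L` are still to be processed, and `J` is the
final edge set. -/
structure Deleting (G : Multigraph (Fin n) (Fin m)) (F : Finset (Finset (Fin n)))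
    (J : Finset (Fin m)) (L : List (Fin m)) (σ : Store) : Prop where
  nodup : L.Nodup
  subset : L.toFinset ⊆ decodeEdges m (σ.nat 3)
  listed : Listed L (σ.nat 4)
  length : σ.nat 5 0 = L.length
  result : reverseDelete G F L (decodeEdges m (σ.nat 3)) = J

theorem runs_deletion (hO : IsCoreOracle G F O) {J : Finset (Fin m)} {e : Fin m}
    (h : Deleting G F J (e :: L) σ) : Runs O deletion σ 20 (Deleting G F J L) := by
  have hnd := List.nodup_cons.1 h.nodup
  have h5 : σ.nat 5 0 = L.length + 1 := h.length
  have he : e ∈ decodeEdges m (σ.nat 3) := h.subset (by simp)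
  have hsub : L.toFinset ⊆ (decodeEdges m (σ.nat 3)).erase e := fun x hx =>
    Finset.mem_erase.2 ⟨fun hxe => hnd.1 (by simpa [hxe] using hx), h.subset (by
      rw [List.mem_toFinset] at hx ⊢
      exact List.mem_cons_of_mem e hx)⟩
  have hres := h.result
  simp only [reverseDelete] at hres
  refine Runs.seq (Q' := fun τ => τ.nat 5 0 = L.length ∧ τ.nat 4 = σ.nat 4 ∧ τ.nat 3 = σ.nat 3)
    (S := 6) (T := 14) (Runs.setNat (by rfl) ?_) ?_ (by omega)
  · simp [writeNat_nat, NExp.eval, h5]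
  rintro τ ⟨hτ5, hτ4, hτ3⟩
  have hlast : τ.nat 4 L.length = e := by rw [hτ4]; exact h.listed.1
  refine Runs.seq (Q' := fun υ => υ.nat 5 0 = L.length ∧ υ.nat 4 = σ.nat 4 ∧
    υ.nat 3 = Function.update (σ.nat 3) e 0) (S := 5) (T := 9) (Runs.setNat (by rfl) ?_) ?_
    (by omega)
  · simp [writeNat_nat, NExp.eval, hτ5, hlast, hτ4, hτ3]
  rintro υ ⟨hυ5, hυ4, hυ3⟩
  have hJ : decodeEdges m (υ.nat 3) = (decodeEdges m (σ.nat 3)).erase e := by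
    rw [hυ3, decodeEdges_update_zero]
  have hb : BExp.Holds O υ (.natLe (.lit 1) (.coreCount 3)) ↔
      ¬ G.IsCover F ((decodeEdges m (σ.nat 3)).erase e) := by
    rw [← hO.one_le_length_iff, ← hJ]
    rfl
  refine Runs.ite (T := 5) (fun hτ => ?_) (fun hτ => ?_) (by rfl)
  · rw [hb] at hτ
    rw [if_neg hτ] at hres
    have hlast' : υ.nat 4 L.length = e := by rw [hυ4, ← hτ4, hlast]
    have hJ' : decodeEdges m ((υ.writeNat 3 e 1).nat 3) = decodeEdges m (σ.nat 3) := by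
      rw [writeNat_nat, if_pos rfl, decodeEdges_update_one, hJ, Finset.insert_erase he]
    refine Runs.setNat (by rfl) ?_
    simp only [NExp.eval, hυ5, hlast']
    refine ⟨hnd.2, ?_, ?_, ?_, ?_⟩
    · rw [hJ']
      exact hsub.trans (Finset.erase_subset _ _)
    · rw [writeNat_nat, if_neg (by decide), hυ4]
      exact h.listed.2
    · rw [writeNat_nat, if_neg (by decide), hυ5]
    · rw [hJ', hres]
  · rw [hb, not_not] at hτ
    rw [if_pos hτ] at hres
    exact Runs.skip (by omega) ⟨hnd.2, by rw [hJ]; exact hsub, by rw [hυ4]; exact h.listed.2, hυ5,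
      by rw [hJ, hres]⟩

theorem runs_phase2 (hO : IsCoreOracle G F O) {J : Finset (Fin m)} (h : Deleting G F J L σ) :
    Runs O phase2 σ (m * 25 + 5) fun τ => outputEdges m τ = J := by
  have hlen : L.length ≤ m := by simpa using h.nodup.length_le_card
  refine (Runs.loop (T := 20) (Inv := fun k τ => ∃ L, L.length = k ∧ Deleting G F J L τ) ?_
    L.length ⟨L, rfl, h⟩).mono ?_ ?_
  · rintro k τ ⟨L, hk, hL⟩ hτ
    simp only [BExp.Holds, NExp.eval, hL.length] at hτ
    cases L with
    | nil => simp at hτ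
    | cons e L =>
      exact ⟨L.length, hk.symm, (runs_deletion hO hL).mono le_rfl fun υ hυ => ⟨L, rfl, hυ⟩⟩
  · simp only [BExp.steps, NExp.steps]
    omega
  · rintro τ ⟨⟨k, L, -, hL⟩, hτ⟩
    simp only [BExp.Holds, NExp.eval, hL.length] at hτ
    obtain rfl : L = [] := List.length_eq_zero_iff.1 (by omega)
    exact hL.result

theorem represents_inputStore (G : Multigraph (Fin n) (Fin m)) (c : Fin m → ℝ)
    (F : Finset (Finset (Fin n))) : Represents G c F [] (fun _ => 0) (inputStore G c) where
  graph := ⟨by simp [inputStore], fun e => by simp [inputStore], fun e => by simp [inputStore]⟩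
  edges := by ext e; simp [inputStore, decodeEdges]
  listed := trivial
  length := by simp [inputStore]
  rest e := by simp [inputStore, load]
  phase := .start

theorem runs_wgmv (hc : ∀ e, 0 ≤ c e) (hF : Pliable F) (hcov : G.IsCover F Finset.univ)
    (hO : IsCoreOracle G F O) :
    Runs O wgmv (inputStore G c) (m * (m * (47 * n + 94) + 75) + 9) fun τ =>
      IsWGMVOutput G c F (outputEdges m τ) := by
  refine Runs.seq (runs_phase1 hc hF hcov hO (represents_inputStore G c F)) ?_
    (T := m * 25 + 5) (by nlinarith)
  rintro τ ⟨L, y, hL, hLc⟩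
  refine (runs_phase2 hO ⟨hL.phase.nodup, hL.edges.ge, hL.listed, hL.length, rfl⟩).mono le_rfl ?_
  intro υ hυ
  exact ⟨L, y, hL.phase, cores_residual_eq_empty_iff.2 hLc, by rw [hυ, hL.edges]⟩

end Program

end SetCover

open SetCover in
/-- For Set Family Edge Cover with a γ-pliable family and non-negative edge costs:
(1) every output of the primal-dual algorithm with reverse delete is a 7-approximate solution;
(2) one fixed program, with an oracle for the cores of the residual families, computes such an
output within a number of steps that is polynomial in the numbers of nodes and edges, whenever a
feasible solution exists;
(3) the bound on the degrees of the cores for an inclusion-minimal cover in which every edge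
covers some core. -/
theorem theorem1 :
    (∀ (V E : Type*) [Fintype V] [DecidableEq V] [Fintype E] [DecidableEq E]
        (G : Multigraph V E) (c : E → ℝ) (F : Finset (Finset V)),
        (∀ e, 0 ≤ c e) → GammaPliable G F →
        ∀ J : Finset E, IsWGMVOutput G c F J → IsApproxSolution G c F 7 J) ∧
    (∃ (P : Cmd) (p : Polynomial ℕ),
        ∀ (n m : ℕ) (G : Multigraph (Fin n) (Fin m)) (c : Fin m → ℝ)
          (F : Finset (Finset (Fin n))) (O : Oracle n m),
          (∀ e, 0 ≤ c e) → GammaPliable G F → G.IsCover F Finset.univ → IsCoreOracle G F O →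
          ∃ (τ : Store) (t : ℕ), Exec O P (inputStore G c) τ t ∧ t ≤ p.eval (n + m) ∧
            IsWGMVOutput G c F (outputEdges m τ) ∧
            IsApproxSolution G c F 7 (outputEdges m τ)) ∧
    (∀ (V E : Type*) [Fintype V] [DecidableEq V] [Fintype E] [DecidableEq E]
        (G : Multigraph V E) (F : Finset (Finset V)) (I : Finset E),
        GammaPliable G F → Minimal (G.IsCover F) I →
        (∀ e ∈ I, ∃ C ∈ cores F, G.Covers e C) →
        ∑ C ∈ cores F, G.deg I C ≤ 7 * (cores F).card) := by
  refine ⟨fun V E _ _ _ _ G c F hc hF J hJ => hJ.isApproxSolution hc hF, ?_,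
    fun V E _ _ _ _ G F I hF hI hcore => sum_deg_cores_le_of_covers_core hF hI hcore⟩
  refine ⟨Program.wgmv, 47 * Polynomial.X ^ 3 + 94 * Polynomial.X ^ 2 + 75 * Polynomial.X + 9, ?_⟩
  intro n m G c F O hc hF hcov hO
  obtain ⟨τ, t, h1, h2, h3⟩ := Program.runs_wgmv hc hF.1 hcov hO
  refine ⟨τ, t, h1, h2.trans ?_, h3, h3.isApproxSolution hc hF⟩
  have hm : m ≤ n + m := Nat.le_add_left m n
  have hn : n ≤ n + m := Nat.le_add_right n m
  calc m * (m * (47 * n + 94) + 75) + 9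
      ≤ (n + m) * ((n + m) * (47 * (n + m) + 94) + 75) + 9 := by gcongr
    _ = Polynomial.eval (n + m)
        (47 * Polynomial.X ^ 3 + 94 * Polynomial.X ^ 2 + 75 * Polynomial.X + 9) := by
      simp only [Polynomial.eval_add, Polynomial.eval_mul, Polynomial.eval_pow, Polynomial.eval_X,
        Polynomial.eval_ofNat]
      ring
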